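/- \textbf{Definitions.} Let $f\colon[a,b]\to\mathbb{R}$. A continuous $U\colon[a,b]\to\mathbb{R}$ is a \emph{major function} of $f$ if at every $x\in[a,b]$ its lower Laplace derivate, i.e. the smaller of $$\liminf_{s\to\infty}s^{2}\int_{0}^{\delta}e^{-st}[U(x+t)-U(x)]\,dt,\qquad \liminf_{s\to\infty}(-s^{2})\int_{0}^{\delta}e^{-st}[U(x-t)-U(x)]\,dt$$ (for some small $\delta>0$, the choice being immaterial; only the one-sided expression that makes sense is used at an end point), is at least $f(x)$. A \emph{minor function} $V$ is continuous with the corresponding upper derivates (limsup, the larger of the two) at most $f(x)$. The function $f$ is \emph{Laplace integrable} on $[a,b]$, with integral $A\in\mathbb{R}$, if $\inf_U\,[U(b)-U(a)]=\sup_V\,[V(b)-V(a)]=A$. It is Laplace integrable on $[a,\infty)$ if it is so on $[a,c]$ for all $c\ge a$ and $\int_a^\infty f:=\lim_{c\to\infty}\int_a^c f$ exists in $\mathbb{R}$; similarly on $(-\infty,a]$; and on $\mathbb{R}$ if for some $a$ it is so on both $(-\infty,a]$ and $[a,\infty)$, with $\int_{\mathbb{R}}f=\int_{-\infty}^a f+\int_a^\infty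 f$. Complex-valued functions are integrated by real and imaginary parts. Let $\mathcal{LP}(\mathbb{R})$ be the set of Laplace integrable functions on $\mathbb{R}$ and $\mathcal{LP}_{loc}(\mathbb{R})$ the set of functions that are Laplace integrable on every compact interval. For $f\colon\mathbb{R}\to\mathbb{R}$ and $y\in\mathbb{R}$ we say that $\widehat f(y)=\int_{-\infty}^{\infty}f(x)e^{-2\pi iyx}\,dx$ exists if this Laplace integral exists. \textbf{Theorem (Existence theorems).} Let $f\colon\mathbb{R}\to\mathbb{R}$. (a) If $f\in\mathcal{LP}_{loc}(\mathbb{R})$ and $f$ is Lebesgue integrable on $\mathbb{R}\setminus(-a,a)$ for some $a\in\mathbb{R}$, then $\widehat f(y)$ exists for every $y\in\mathbb{R}$. (b) If $f\in\mathcal{LP}(\mathbb{R})$ and $f$ is of bounded variation on $\mathbb{R}\setminus(-a,a)$ for some $a\in\mathbb{R}$, then $\widehat f(y)$ exists for every $y\in\mathbb{R}$. Moreover, there is a function $\Phi\in\mathcal{LP}(\mathbb{R})$, vanishing outside $[0,1]$, which is not locally Henstock--Kurzweil integrable (it fails to be Henstock--Kurzweil integrable on some compact interval), and for which $\widehat\Phi(y)$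 exists for every $y\in\mathbb{R}$. -/

import Mathlib

open Filter Topology Set MeasureTheory

noncomputable section

/-- The right-hand Laplace difference quotient `s² ∫₀^δ e^{-st} (F(x+t) - F(x)) dt`. -/
def laplaceQuotRight (F : ℝ → ℝ) (x δ s : ℝ) : ℝ :=
  s ^ 2 * ∫ t in (0 : ℝ)..δ, Real.exp (-s * t) * (F (x + t) - F x)

/-- The left-hand Laplace difference quotient `-s² ∫₀^δ e^{-st} (F(x-t) - F(x)) dt`. -/
def laplaceQuotLeft (F : ℝ → ℝ) (x δ s : ℝ) : ℝ :=
  -s ^ 2 * ∫ t in (0 : ℝ)..δ, Real.exp (-s * t) * (F (x - t) - F x)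

/-- Lower right Laplace derivate of `F` at `x`. For `F` continuous on `[x, x + δ]` its value does
not depend on `δ > 0`; the same holds for the three other derivates. -/
def lowerLaplaceDerivRight (F : ℝ → ℝ) (x δ : ℝ) : EReal :=
  liminf (fun s : ℝ => (laplaceQuotRight F x δ s : EReal)) atTop

/-- Upper right Laplace derivate. -/
def upperLaplaceDerivRight (F : ℝ → ℝ) (x δ : ℝ) : EReal :=
  limsup (fun s : ℝ => (laplaceQuotRight F x δ s : EReal)) atTop

/-- Lower left Laplace derivate. -/
def lowerLaplaceDerivLeft (F : ℝ → ℝ) (x δ : ℝ) : EReal :=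
  liminf (fun s : ℝ => (laplaceQuotLeft F x δ s : EReal)) atTop

/-- Upper left Laplace derivate. -/
def upperLaplaceDerivLeft (F : ℝ → ℝ) (x δ : ℝ) : EReal :=
  limsup (fun s : ℝ => (laplaceQuotLeft F x δ s : EReal)) atTop

/-- `U` is a major function of `f` on `[a, b]`: it is continuous and its lower Laplace derivate
(the smaller of the two one-sided ones; at an end point, the one that makes sense) is at least `f`
at every point of `[a, b]`. As `f` is real-valued, this derivate is automatically `> -∞`. -/
structure IsLaplaceMajor (f : ℝ → ℝ) (a b : ℝ) (U : ℝ → ℝ) : Prop where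
  continuousOn : ContinuousOn U (Icc a b)
  right : ∀ x ∈ Ico a b, ∃ δ > 0, x + δ ≤ b ∧ (f x : EReal) ≤ lowerLaplaceDerivRight U x δ
  left : ∀ x ∈ Ioc a b, ∃ δ > 0, a ≤ x - δ ∧ (f x : EReal) ≤ lowerLaplaceDerivLeft U x δ

/-- `V` is a minor function of `f` on `[a, b]`: it is continuous and its upper Laplace derivate
is at most `f` at every point of `[a, b]`. -/
structure IsLaplaceMinor (f : ℝ → ℝ) (a b : ℝ) (V : ℝ → ℝ) : Prop where
  continuousOn : ContinuousOn V (Icc a b)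
  right : ∀ x ∈ Ico a b, ∃ δ > 0, x + δ ≤ b ∧ upperLaplaceDerivRight V x δ ≤ (f x : EReal)
  left : ∀ x ∈ Ioc a b, ∃ δ > 0, a ≤ x - δ ∧ upperLaplaceDerivLeft V x δ ≤ (f x : EReal)

/-- `A` is the Laplace integral of `f` over the bounded interval `[a, b]`: the infimum of the
increments of the major functions and the supremum of the increments of the minor functions are
both equal to the real number `A`. (Neither family can be empty: `∅` has no infimum in `ℝ`.) -/
def HasLaplaceIntegralOn (f : ℝ → ℝ) (a b A : ℝ) : Prop :=
  a ≤ b ∧ IsGLB {r | ∃ U, IsLaplaceMajor f a b U ∧ r = U b - U a} A ∧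
    IsLUB {r | ∃ V, IsLaplaceMinor f a b V ∧ r = V b - V a} A

/-- `f` is Laplace integrable on the bounded interval `[a, b]`. -/
def LaplaceIntegrableOn (f : ℝ → ℝ) (a b : ℝ) : Prop :=
  ∃ A, HasLaplaceIntegralOn f a b A

/-- `f` is Laplace integrable on every compact interval. -/
def LocallyLaplaceIntegrable (f : ℝ → ℝ) : Prop :=
  ∀ a b : ℝ, a ≤ b → LaplaceIntegrableOn f a b

/-- `A` is the Laplace integral of `f` over `[a, ∞)`. -/
def HasLaplaceIntegralIci (f : ℝ → ℝ) (a A : ℝ) : Prop :=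
  ∃ F : ℝ → ℝ, (∀ c, a ≤ c → HasLaplaceIntegralOn f a c (F c)) ∧ Tendsto F atTop (𝓝 A)

/-- `A` is the Laplace integral of `f` over `(-∞, b]`. -/
def HasLaplaceIntegralIic (f : ℝ → ℝ) (b A : ℝ) : Prop :=
  ∃ F : ℝ → ℝ, (∀ c, c ≤ b → HasLaplaceIntegralOn f c b (F c)) ∧ Tendsto F atBot (𝓝 A)

/-- `A` is the Laplace integral of `f` over `ℝ`. -/
def HasLaplaceIntegral (f : ℝ → ℝ) (A : ℝ) : Prop :=
  ∃ a B C : ℝ, HasLaplaceIntegralIic f a B ∧ HasLaplaceIntegralIci f a C ∧ A = B + C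

/-- `f` is Laplace integrable on `ℝ`. -/
def LaplaceIntegrable (f : ℝ → ℝ) : Prop :=
  ∃ A, HasLaplaceIntegral f A

/-- The Laplace integral over `ℝ` of a complex-valued function, by real and imaginary parts. -/
def HasComplexLaplaceIntegral (g : ℝ → ℂ) (z : ℂ) : Prop :=
  HasLaplaceIntegral (fun x => (g x).re) z.re ∧ HasLaplaceIntegral (fun x => (g x).im) z.im

/-- `z` is the value at `y` of the Fourier transform of `f`, `∫ f(x) e^{-2πiyx} dx`, the integral
being a Laplace integral. -/
def HasLaplaceFourierAt (f : ℝ → ℝ) (y : ℝ) (z : ℂ) : Prop :=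
  HasComplexLaplaceIntegral
    (fun x => (f x : ℂ) * Complex.exp (-2 * Real.pi * Complex.I * y * x)) z

/-- The Fourier transform of `f` exists at `y`. -/
def LaplaceFourierExistsAt (f : ℝ → ℝ) (y : ℝ) : Prop :=
  ∃ z, HasLaplaceFourierAt f y z

/-- `f` is Lebesgue integrable on `ℝ \ (-a, a)` for some `a`. -/
def LebesgueIntegrableNearInfty (f : ℝ → ℝ) : Prop :=
  ∃ a : ℝ, IntegrableOn f (Ioo (-a) a)ᶜ volume

/-- `f` is of bounded variation on `ℝ \ (-a, a)` for some `a`. -/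
def BoundedVariationNearInfty (f : ℝ → ℝ) : Prop :=
  ∃ a : ℝ, BoundedVariationOn f (Ioo (-a) a)ᶜ

/-- `f` is Henstock–Kurzweil integrable on `[a, b]`. -/
def HKIntegrableOn (f : ℝ → ℝ) (a b : ℝ) (hab : a < b) : Prop :=
  BoxIntegral.Integrable (⟨fun _ => a, fun _ => b, fun _ => hab⟩ : BoxIntegral.Box (Fin 1))
    BoxIntegral.IntegrationParams.Henstock (fun x => f (x 0))
    (BoxIntegral.BoxAdditiveMap.volume : BoxIntegral.BoxAdditiveMap (Fin 1) (ℝ →L[ℝ] ℝ) ⊤)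

/-- `f` is Henstock–Kurzweil integrable on every compact interval. -/
def LocallyHKIntegrable (f : ℝ → ℝ) : Prop :=
  ∀ (a b : ℝ) (hab : a < b), HKIntegrableOn f a b hab

end

/-! A Laplace derivate sees `F` near a point only through an exponential average, but this average
still controls monotonicity: if `F (x + t) ≤ F x` for all small `t > 0`, the right quotient is
nonpositive. So a continuous function with nonnegative lower right derivates is nondecreasing
(`le_of_lowerLaplaceRightGE_zero`), major minus minor functions are nondecreasing, and integrability
becomes a Cauchy criterion (`laplaceIntegrableOn_iff`). Integration by parts, `U g - ∫ U g'`, turns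
a major function of `f` into one of `f g` for positive `C¹` functions `g`. Hence multiplication by
sines and cosines preserves local integrability, and only convergence at infinity remains, where the
integrals are Lebesgue integrals. In (a) the tail is dominated by `|f|`. In (b) `f` tends to `0`,
and a shift `h` with `g (x + h) = -g x` reduces `∫ f g` to `∫ (f x - f (x + h)) g x`, which
converges absolutely because the variation is bounded. The other half-line follows by reflection.

For the example, each gap of generation `j` of the Cantor set carries a piece of a function `H` such
that `|H|` is at most the cube of the distance to the Cantor set, while `F = H'` oscillates by a
multiple of `(2 / 3) ^ j`. Then `F` is continuous and is differentiable in the gaps; at Cantor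
points the cubic bound on `H` makes the Laplace derivates of `F` vanish
(`lowerLaplaceRightGE_zero_of_primitive`). Thus `F` is both a major and a minor function of the
example. If the example were Henstock–Kurzweil integrable, take a gauge for it. By Baire
(`exists_portion_of_gauge`) the gauge is bounded below on a dense subset of a portion of the Cantor
set. That portion is close to `2 ^ n` gaps of generation `i + n`, and tagging at such points, where
the function is `0`, the Henstock lemma bounds the total oscillation of `F` over these gaps. But
this total grows like `2 ^ n * (2 / 3) ^ n`. -/

/-! ### Left-right and sign symmetries of Laplace derivates. -/

/-- The function `z ↦ -F (-z)`, which exchanges the left and right Laplace quotients. -/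
def negReflect (F : ℝ → ℝ) : ℝ → ℝ := fun z => -F (-z)

lemma negReflect_negReflect (F : ℝ → ℝ) : negReflect (negReflect F) = F := by
  funext z; simp [negReflect]

lemma Continuous.negReflect {F : ℝ → ℝ} (hF : Continuous F) : Continuous (negReflect F) :=
  (hF.comp continuous_neg).neg

/-- Reflection removes the left-hand arguments: afterwards only right-hand quotients have to be
estimated. -/
lemma laplaceQuotLeft_eq (F : ℝ → ℝ) (x δ s : ℝ) :
    laplaceQuotLeft F x δ s = laplaceQuotRight (negReflect F) (-x) δ s := by
  unfold laplaceQuotLeft laplaceQuotRight negReflect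
  rw [neg_mul, ← mul_neg, ← intervalIntegral.integral_neg]
  congr 1
  refine intervalIntegral.integral_congr fun t _ => ?_
  have : -(-x + t) = x - t := by ring
  simp only [this, neg_neg]
  ring

lemma laplaceQuotRight_neg (F : ℝ → ℝ) (x δ s : ℝ) :
    laplaceQuotRight (fun z => -F z) x δ s = -laplaceQuotRight F x δ s := by
  unfold laplaceQuotRight
  rw [← mul_neg, ← intervalIntegral.integral_neg]
  congr 1
  refine intervalIntegral.integral_congr fun t _ => ?_
  ring

lemma coe_le_liminf_coe_iff (q : ℝ → ℝ) (c : ℝ) :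
    (c : EReal) ≤ liminf (fun s => (q s : EReal)) atTop ↔ ∀ c' < c, ∀ᶠ s in atTop, c' < q s := by
  rw [le_liminf_iff]
  constructor
  · intro h c' hc'
    filter_upwards [h c' (by exact_mod_cast hc')] with s hs
    exact_mod_cast hs
  · intro h y hy
    obtain ⟨r, hr, hrc⟩ := EReal.lt_iff_exists_real_btwn.1 hy
    filter_upwards [h r (by exact_mod_cast hrc)] with s hs
    exact hr.trans (by exact_mod_cast hs)

lemma limsup_coe_le_coe_iff (q : ℝ → ℝ) (c : ℝ) :
    limsup (fun s => (q s : EReal)) atTop ≤ (c : EReal) ↔ ∀ c' > c, ∀ᶠ s in atTop, q s < c' := by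
  rw [limsup_le_iff]
  constructor
  · intro h c' hc'
    filter_upwards [h c' (by exact_mod_cast hc')] with s hs
    exact_mod_cast hs
  · intro h y hy
    obtain ⟨r, hr, hrc⟩ := EReal.lt_iff_exists_real_btwn.1 hy
    filter_upwards [h r (by exact_mod_cast hr)] with s hs
    exact lt_trans (by exact_mod_cast hs) hrc

lemma limsup_coe_le_coe_iff_le_liminf_neg (q : ℝ → ℝ) (c : ℝ) :
    limsup (fun s => (q s : EReal)) atTop ≤ (c : EReal) ↔
      ((-c : ℝ) : EReal) ≤ liminf (fun s => ((-q s : ℝ) : EReal)) atTop := by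
  rw [limsup_coe_le_coe_iff, coe_le_liminf_coe_iff]
  constructor
  · intro h c' hc'
    filter_upwards [h (-c') (by linarith)] with s hs
    linarith
  · intro h c' hc'
    filter_upwards [h (-c') (by linarith)] with s hs
    linarith

lemma upperLaplaceDerivRight_le_iff (F : ℝ → ℝ) (x δ c : ℝ) :
    upperLaplaceDerivRight F x δ ≤ (c : EReal) ↔
      ((-c : ℝ) : EReal) ≤ lowerLaplaceDerivRight (fun z => -F z) x δ := by
  unfold upperLaplaceDerivRight lowerLaplaceDerivRight
  rw [limsup_coe_le_coe_iff_le_liminf_neg]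
  simp only [laplaceQuotRight_neg]

lemma lowerLaplaceDerivLeft_eq (F : ℝ → ℝ) (x δ : ℝ) :
    lowerLaplaceDerivLeft F x δ = lowerLaplaceDerivRight (negReflect F) (-x) δ := by
  unfold lowerLaplaceDerivLeft lowerLaplaceDerivRight
  simp only [laplaceQuotLeft_eq]

lemma upperLaplaceDerivLeft_le_iff (F : ℝ → ℝ) (x δ c : ℝ) :
    upperLaplaceDerivLeft F x δ ≤ (c : EReal) ↔
      ((-c : ℝ) : EReal) ≤ lowerLaplaceDerivLeft (fun z => -F z) x δ := by
  have : negReflect (fun z => -F z) = fun z => -negReflect F z := rfl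
  rw [lowerLaplaceDerivLeft_eq, this, ← upperLaplaceDerivRight_le_iff]
  unfold upperLaplaceDerivLeft upperLaplaceDerivRight
  simp only [laplaceQuotLeft_eq]

/-- Minor functions are handled through this change of sign, so that estimates are needed for major
functions only. -/
lemma isLaplaceMinor_iff {f V : ℝ → ℝ} {a b : ℝ} :
    IsLaplaceMinor f a b V ↔ IsLaplaceMajor (fun x => -f x) a b (fun x => -V x) := by
  constructor
  · rintro ⟨h1, h2, h3⟩
    refine ⟨h1.neg, fun x hx => ?_, fun x hx => ?_⟩
    · obtain ⟨δ, h, h', h''⟩ := h2 x hx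
      exact ⟨δ, h, h', (upperLaplaceDerivRight_le_iff _ _ _ _).1 h''⟩
    · obtain ⟨δ, h, h', h''⟩ := h3 x hx
      exact ⟨δ, h, h', (upperLaplaceDerivLeft_le_iff _ _ _ _).1 h''⟩
  · rintro ⟨h1, h2, h3⟩
    refine ⟨h1.neg.congr fun x _ => (neg_neg _).symm, fun x hx => ?_, fun x hx => ?_⟩
    · obtain ⟨δ, h, h', h''⟩ := h2 x hx
      exact ⟨δ, h, h', (upperLaplaceDerivRight_le_iff _ _ _ _).2 h''⟩
    · obtain ⟨δ, h, h', h''⟩ := h3 x hx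
      exact ⟨δ, h, h', (upperLaplaceDerivLeft_le_iff _ _ _ _).2 h''⟩

lemma isLaplaceMajor_neg_iff {f U : ℝ → ℝ} {a b : ℝ} :
    IsLaplaceMajor f a b U ↔ IsLaplaceMinor (fun x => -f x) a b (fun x => -U x) := by
  simp [isLaplaceMinor_iff]

lemma IsLaplaceMajor.negReflect {f U : ℝ → ℝ} {a b : ℝ} (h : IsLaplaceMajor f a b U) :
    IsLaplaceMajor (fun x => f (-x)) (-b) (-a) (negReflect U) := by
  refine ⟨?_, fun x hx => ?_, fun x hx => ?_⟩
  · refine (h.continuousOn.comp continuousOn_neg fun x hx => ?_).neg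
    exact ⟨by linarith [hx.2], by linarith [hx.1]⟩
  · obtain ⟨δ, h1, h2, h3⟩ := h.left (-x) ⟨by linarith [hx.2], by linarith [hx.1]⟩
    rw [lowerLaplaceDerivLeft_eq, neg_neg] at h3
    exact ⟨δ, h1, by linarith, h3⟩
  · obtain ⟨δ, h1, h2, h3⟩ := h.right (-x) ⟨by linarith [hx.2], by linarith [hx.1]⟩
    refine ⟨δ, h1, by linarith, ?_⟩
    rw [lowerLaplaceDerivLeft_eq, negReflect_negReflect]
    exact h3

lemma IsLaplaceMinor.negReflect {f V : ℝ → ℝ} {a b : ℝ} (h : IsLaplaceMinor f a b V) :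
    IsLaplaceMinor (fun x => f (-x)) (-b) (-a) (negReflect V) :=
  isLaplaceMinor_iff.2 (isLaplaceMinor_iff.1 h).negReflect

/-! ### Lower right Laplace derivates of continuous functions and monotonicity. -/

/-- The lower right Laplace derivate of a continuous function `F` at `x` is at least `c`. -/
def LowerLaplaceRightGE (F : ℝ → ℝ) (x c : ℝ) : Prop :=
  ∀ c' < c, ∀ᶠ s in atTop, c' < laplaceQuotRight F x 1 s

lemma tendsto_sq_mul_exp_neg_mul {m : ℝ} (hm : 0 < m) (n : ℕ) :
    Tendsto (fun s : ℝ => s ^ n * Real.exp (-s * m)) atTop (𝓝 0) := by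
  have h1 := (Real.tendsto_pow_mul_exp_neg_atTop_nhds_zero n).comp
    (tendsto_id.atTop_mul_const hm)
  have h2 := h1.const_mul ((m ^ n)⁻¹)
  rw [mul_zero] at h2
  refine h2.congr fun s => ?_
  simp only [Function.comp, id, mul_pow]
  field_simp

lemma continuous_laplace_integrand {F : ℝ → ℝ} (hF : Continuous F) (x s : ℝ) :
    Continuous fun t => Real.exp (-s * t) * (F (x + t) - F x) := by fun_prop

/-- The difference is an integral over an interval bounded away from `0`, where `exp (-s * t)` beats
the factor `s ^ 2`. This is why `δ` can be fixed to `1` in `LowerLaplaceRightGE`. -/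
lemma tendsto_laplaceQuotRight_sub {F : ℝ → ℝ} (hF : Continuous F) (x : ℝ) {δ δ' : ℝ}
    (hδ : 0 < δ) (hδ' : 0 < δ') :
    Tendsto (fun s => laplaceQuotRight F x δ s - laplaceQuotRight F x δ' s) atTop (𝓝 0) := by
  obtain ⟨M, hM⟩ := (isCompact_uIcc (a := δ') (b := δ)).exists_bound_of_continuousOn
    (f := fun t => F (x + t) - F x) (by fun_prop)
  have hm : 0 < min δ' δ := lt_min hδ' hδ
  have h0 := (tendsto_sq_mul_exp_neg_mul hm 2).mul_const (M * |δ - δ'|)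
  rw [zero_mul] at h0
  refine squeeze_zero_norm' ?_ h0
  filter_upwards [eventually_ge_atTop 0] with s hs
  have e : laplaceQuotRight F x δ s - laplaceQuotRight F x δ' s =
      s ^ 2 * ∫ t in δ'..δ, Real.exp (-s * t) * (F (x + t) - F x) := by
    unfold laplaceQuotRight
    rw [← mul_sub, intervalIntegral.integral_interval_sub_left] <;>
    exact (continuous_laplace_integrand hF x s).intervalIntegrable _ _
  rw [e, norm_mul, Real.norm_of_nonneg (sq_nonneg s), mul_assoc, ← mul_assoc (Real.exp _)]
  refine mul_le_mul_of_nonneg_left ?_ (sq_nonneg s)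
  refine intervalIntegral.norm_integral_le_of_norm_le_const fun t ht => ?_
  rw [norm_mul, Real.norm_of_nonneg (Real.exp_pos _).le]
  have ht' : min δ' δ ≤ t := ht.1.le
  refine mul_le_mul (Real.exp_le_exp.2 ?_) (hM t (uIoc_subset_uIcc ht)) (norm_nonneg _)
    (Real.exp_pos _).le
  nlinarith

lemma lowerLaplaceRightGE_iff {F : ℝ → ℝ} (hF : Continuous F) {x δ c : ℝ} (hδ : 0 < δ) :
    LowerLaplaceRightGE F x c ↔ (c : EReal) ≤ lowerLaplaceDerivRight F x δ := by
  unfold LowerLaplaceRightGE lowerLaplaceDerivRight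
  rw [coe_le_liminf_coe_iff]
  have key : ∀ {δ δ' : ℝ}, 0 < δ → 0 < δ' →
      (∀ c' < c, ∀ᶠ s in atTop, c' < laplaceQuotRight F x δ s) →
      ∀ c' < c, ∀ᶠ s in atTop, c' < laplaceQuotRight F x δ' s := by
    intro δ δ' h1 h2 h c' hc'
    have := tendsto_laplaceQuotRight_sub hF x h1 h2
    filter_upwards [h ((c + c') / 2) (by linarith),
      this.eventually_lt_const (show 0 < (c - c') / 2 by linarith)] with s hs hs'
    linarith
  exact ⟨key one_pos hδ, key hδ one_pos⟩

lemma isLaplaceMajor_iff_of_continuous {f U : ℝ → ℝ} (hU : Continuous U) {a b : ℝ} :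
    IsLaplaceMajor f a b U ↔ (∀ x ∈ Ico a b, LowerLaplaceRightGE U x (f x)) ∧
      ∀ x ∈ Ioc a b, LowerLaplaceRightGE (negReflect U) (-x) (f x) := by
  constructor
  · rintro ⟨-, h2, h3⟩
    refine ⟨fun x hx => ?_, fun x hx => ?_⟩
    · obtain ⟨δ, h, h', h''⟩ := h2 x hx
      exact (lowerLaplaceRightGE_iff hU h).2 h''
    · obtain ⟨δ, h, h', h''⟩ := h3 x hx
      rw [lowerLaplaceDerivLeft_eq] at h''
      exact (lowerLaplaceRightGE_iff hU.negReflect h).2 h''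
  · rintro ⟨h2, h3⟩
    refine ⟨hU.continuousOn, fun x hx => ?_, fun x hx => ?_⟩
    · have : 0 < b - x := by linarith [hx.2]
      exact ⟨b - x, this, by linarith, (lowerLaplaceRightGE_iff hU this).1 (h2 x hx)⟩
    · have : 0 < x - a := by linarith [hx.1]
      refine ⟨x - a, this, by linarith, ?_⟩
      rw [lowerLaplaceDerivLeft_eq]
      exact (lowerLaplaceRightGE_iff hU.negReflect this).1 (h3 x hx)

lemma lowerLaplaceDerivRight_congr {F G : ℝ → ℝ} {x δ : ℝ} (hδ : 0 < δ)
    (h : EqOn F G (Icc x (x + δ))) :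
    lowerLaplaceDerivRight F x δ = lowerLaplaceDerivRight G x δ := by
  unfold lowerLaplaceDerivRight laplaceQuotRight
  congr 1
  funext s
  congr 2
  refine intervalIntegral.integral_congr fun t ht => ?_
  rw [uIcc_of_le hδ.le] at ht
  rw [h ⟨by linarith [ht.1], by linarith [ht.2]⟩, h ⟨le_rfl, by linarith⟩]

lemma IsLaplaceMajor.congr {f U W : ℝ → ℝ} {a b : ℝ} (h : IsLaplaceMajor f a b U)
    (e : EqOn U W (Icc a b)) : IsLaplaceMajor f a b W := by
  refine ⟨h.continuousOn.congr e.symm, fun x hx => ?_, fun x hx => ?_⟩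
  · obtain ⟨δ, h1, h2, h3⟩ := h.right x hx
    refine ⟨δ, h1, h2, ?_⟩
    rwa [← lowerLaplaceDerivRight_congr h1 fun z hz => e ⟨hx.1.trans hz.1, hz.2.trans h2⟩]
  · obtain ⟨δ, h1, h2, h3⟩ := h.left x hx
    refine ⟨δ, h1, h2, ?_⟩
    rw [lowerLaplaceDerivLeft_eq] at h3 ⊢
    rwa [← lowerLaplaceDerivRight_congr h1]
    intro z hz
    unfold _root_.negReflect
    rw [e ⟨by linarith [hz.2], by linarith [hz.1, hx.2]⟩]

/-- A major function may be taken to be continuous on the whole line. -/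
lemma IsLaplaceMajor.exists_continuous {f U : ℝ → ℝ} {a b : ℝ} (hab : a ≤ b)
    (h : IsLaplaceMajor f a b U) :
    ∃ W, Continuous W ∧ IsLaplaceMajor f a b W ∧ EqOn W U (Icc a b) := by
  have e : EqOn (IccExtend hab ((Icc a b).domRestrict U)) U (Icc a b) := fun x hx => by
    rw [IccExtend_of_mem _ _ hx]; rfl
  exact ⟨_, (continuousOn_iff_continuous_domRestrict.1 h.continuousOn).Icc_extend', h.congr e.symm, e⟩

lemma LowerLaplaceRightGE.add {F G : ℝ → ℝ} (hF : Continuous F) (hG : Continuous G) {x c d : ℝ}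
    (h : LowerLaplaceRightGE F x c) (h' : LowerLaplaceRightGE G x d) :
    LowerLaplaceRightGE (fun z => F z + G z) x (c + d) := by
  intro c' hc'
  filter_upwards [h (c - (c + d - c') / 2) (by linarith), h' (d - (c + d - c') / 2) (by linarith)]
    with s h1 h2
  have : laplaceQuotRight (fun z => F z + G z) x 1 s =
      laplaceQuotRight F x 1 s + laplaceQuotRight G x 1 s := by
    unfold laplaceQuotRight
    rw [← mul_add, ← intervalIntegral.integral_add
      ((continuous_laplace_integrand hF x s).intervalIntegrable _ _)
      ((continuous_laplace_integrand hG x s).intervalIntegrable _ _)]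
    congr 1
    refine intervalIntegral.integral_congr fun t _ => ?_
    simp only
    ring
  rw [this]
  linarith

lemma LowerLaplaceRightGE.const_mul {F : ℝ → ℝ} {x c k : ℝ} (hk : 0 < k)
    (h : LowerLaplaceRightGE F x c) : LowerLaplaceRightGE (fun z => k * F z) x (k * c) := by
  intro c' hc'
  have : c' / k < c := by rwa [div_lt_iff₀ hk, mul_comm]
  filter_upwards [h _ this] with s hs
  have e : laplaceQuotRight (fun z => k * F z) x 1 s = k * laplaceQuotRight F x 1 s := by
    unfold laplaceQuotRight
    rw [mul_left_comm, ← intervalIntegral.integral_const_mul k]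
    congr 1
    refine intervalIntegral.integral_congr fun t _ => ?_
    simp only
    ring
  rw [e]
  rwa [div_lt_iff₀ hk, mul_comm] at hs

lemma integral_exp_neg_mul_mul_self {s : ℝ} (hs : s ≠ 0) (η : ℝ) :
    ∫ t in (0 : ℝ)..η, Real.exp (-s * t) * t =
      1 / s ^ 2 - (η / s + 1 / s ^ 2) * Real.exp (-s * η) := by
  have hd : ∀ t : ℝ, HasDerivAt (fun t => -((t / s + 1 / s ^ 2) * Real.exp (-s * t)))
      (Real.exp (-s * t) * t) t := by
    intro t
    have h1 : HasDerivAt (fun t : ℝ => t / s + 1 / s ^ 2) (1 / s) t :=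
      ((hasDerivAt_id t).div_const s).add_const _
    have h2 : HasDerivAt (fun t : ℝ => Real.exp (-s * t)) (Real.exp (-s * t) * (-s * 1)) t :=
      ((hasDerivAt_id t).const_mul (-s)).exp
    refine (h1.mul h2).neg.congr_deriv ?_
    field_simp
    ring
  rw [intervalIntegral.integral_eq_sub_of_hasDerivAt (fun t _ => hd t)
    (Continuous.intervalIntegrable (by fun_prop) _ _)]
  simp
  ring

/-- If the increments of `F` dominate `c * t` for small `t > 0`, then the lower right Laplace
derivate is at least `c`. -/
lemma lowerLaplaceRightGE_of_eventually {F : ℝ → ℝ} (hF : Continuous F) {x c : ℝ}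
    (h : ∀ᶠ t in 𝓝[>] (0 : ℝ), c * t ≤ F (x + t) - F x) : LowerLaplaceRightGE F x c := by
  obtain ⟨η, hη, h⟩ := mem_nhdsGT_iff_exists_Ioc_subset.1 h
  have hη : 0 < η := hη
  rw [lowerLaplaceRightGE_iff hF hη]
  unfold lowerLaplaceDerivRight
  rw [coe_le_liminf_coe_iff]
  intro c' hc'
  -- The expression is the exact quotient on `[0, η]` of the linear increment `c * t`; it tends to
  -- `c`.
  have hlim : Tendsto (fun s : ℝ => c * (1 - (η * (s ^ 1 * Real.exp (-s * η)) +
      s ^ 0 * Real.exp (-s * η)))) atTop (𝓝 (c * (1 - (η * 0 + 0)))) :=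
    (tendsto_const_nhds.sub (((tendsto_sq_mul_exp_neg_mul hη 1).const_mul η).add
      (tendsto_sq_mul_exp_neg_mul hη 0))).const_mul c
  simp only [mul_zero, add_zero, sub_zero, mul_one] at hlim
  filter_upwards [hlim.eventually_const_lt hc', eventually_gt_atTop 0] with s hs hs0
  refine hs.trans_le ?_
  have e : c * (1 - (η * (s ^ 1 * Real.exp (-s * η)) + s ^ 0 * Real.exp (-s * η))) =
      s ^ 2 * ∫ t in (0 : ℝ)..η, Real.exp (-s * t) * (c * t) := by
    have : ∀ t : ℝ, Real.exp (-s * t) * (c * t) = c * (Real.exp (-s * t) * t) := fun t => by ring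
    simp only [this]
    rw [intervalIntegral.integral_const_mul, integral_exp_neg_mul_mul_self hs0.ne']
    field_simp
  rw [e]
  unfold laplaceQuotRight
  refine mul_le_mul_of_nonneg_left ?_ (sq_nonneg s)
  refine intervalIntegral.integral_mono_on_of_le_Ioo hη.le
    (Continuous.intervalIntegrable (by fun_prop) _ _)
    ((continuous_laplace_integrand hF x s).intervalIntegrable _ _) fun t ht => ?_
  exact mul_le_mul_of_nonneg_left (h ⟨ht.1, ht.2.le⟩) (Real.exp_pos _).le

lemma lowerLaplaceRightGE_of_hasDerivWithinAt {F : ℝ → ℝ} (hF : Continuous F) {x c : ℝ}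
    (h : HasDerivWithinAt F c (Ioi x) x) : LowerLaplaceRightGE F x c := by
  intro c' hc'
  have hd : (c + c') / 2 < c := by linarith
  have h1 := (hasDerivWithinAt_iff_tendsto_slope' (by simp)).1 h
  have h2 := h1.eventually_const_lt hd
  refine lowerLaplaceRightGE_of_eventually hF (c := (c + c') / 2) ?_ c' (by linarith)
  have h3 : Tendsto (fun t => x + t) (𝓝[>] (0 : ℝ)) (𝓝[>] x) := by
    refine tendsto_nhdsWithin_iff.2 ⟨?_, ?_⟩
    · have : Tendsto (fun t => x + t) (𝓝 (0 : ℝ)) (𝓝 (x + 0)) := tendsto_const_nhds.add tendsto_id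
      rw [add_zero] at this
      exact this.mono_left nhdsWithin_le_nhds
    · filter_upwards [self_mem_nhdsWithin] with t ht
      simpa using ht
  filter_upwards [h3.eventually h2, self_mem_nhdsWithin] with t ht ht0
  have ht0 : 0 < t := ht0
  rw [slope_def_field, add_sub_cancel_left, lt_div_iff₀ ht0] at ht
  exact ht.le

/-- Otherwise the integrand is nonpositive on `(0, η)`, and the quotient with `δ = η` is never
positive. This weak form of increase is all that monotonicity needs. -/
lemma LowerLaplaceRightGE.exists_lt {F : ℝ → ℝ} (hF : Continuous F) {x c : ℝ} (hc : 0 < c)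
    (h : LowerLaplaceRightGE F x c) {η : ℝ} (hη : 0 < η) : ∃ t ∈ Ioo 0 η, F x < F (x + t) := by
  by_contra! hcon
  have h1 := (coe_le_liminf_coe_iff _ _).1 ((lowerLaplaceRightGE_iff hF hη).1 h) 0 hc
  obtain ⟨s, hs⟩ := h1.exists
  refine hs.not_ge ?_
  unfold laplaceQuotRight
  refine mul_nonpos_of_nonneg_of_nonpos (sq_nonneg s) ?_
  have : ∫ t in (0 : ℝ)..η, Real.exp (-s * t) * (F (x + t) - F x) ≤ ∫ t in (0 : ℝ)..η, (0 : ℝ) := by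
    refine intervalIntegral.integral_mono_on_of_le_Ioo hη.le
      ((continuous_laplace_integrand hF x s).intervalIntegrable _ _) (by simp) fun t ht => ?_
    exact mul_nonpos_of_nonneg_of_nonpos (Real.exp_pos _).le (by linarith [hcon t ht])
  simpa using this

/-- A continuous function with nonnegative lower right Laplace derivates is nondecreasing. -/
theorem le_of_lowerLaplaceRightGE_zero {F : ℝ → ℝ} (hF : Continuous F) {a b : ℝ} (hab : a ≤ b)
    (h : ∀ x ∈ Ico a b, LowerLaplaceRightGE F x 0) : F a ≤ F b := by
  -- Adding `ε * z` makes the derivate strictly positive, as `LowerLaplaceRightGE.exists_lt`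
  -- requires; then `ε` tends to `0`.
  have key : ∀ ε > 0, F a + ε * a ≤ F b + ε * b := by
    intro ε hε
    set G : ℝ → ℝ := fun z => F z + ε * z with hG
    have hGc : Continuous G := by fun_prop
    have hG' : ∀ x ∈ Ico a b, LowerLaplaceRightGE G x ε := by
      intro x hx
      have := (h x hx).add hF (G := fun z => ε * z) (by fun_prop)
        (lowerLaplaceRightGE_of_hasDerivWithinAt (c := ε) (by fun_prop)
          (by simpa using ((hasDerivAt_id x).const_mul ε).hasDerivWithinAt))
      simpa using this
    have hcpt : IsCompact (Icc a b ∩ {x | G a ≤ G x}) :=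
      isCompact_Icc.inter_right (isClosed_le continuous_const hGc)
    -- `x` is the last point of `[a, b]` with `G a ≤ G x`. If `x < b`, a later point would qualify
    -- as well.
    obtain ⟨x, ⟨hx, hxG⟩, hmax⟩ := hcpt.exists_isGreatest ⟨a, ⟨le_rfl, hab⟩, le_refl (G a)⟩
    rcases hx.2.eq_or_lt with rfl | hlt
    · exact hxG
    · obtain ⟨t, ht, hGt⟩ := (hG' x ⟨hx.1, hlt⟩).exists_lt hGc hε (sub_pos.2 hlt)
      have : x + t ≤ x := hmax ⟨⟨by linarith [hx.1, ht.1], by linarith [ht.2]⟩,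
        le_trans hxG hGt.le⟩
      linarith [ht.1]
  have h0 : Tendsto (fun ε : ℝ => F b + ε * b - (F a + ε * a)) (𝓝[>] 0) (𝓝 (F b - F a)) := by
    have : Continuous fun ε : ℝ => F b + ε * b - (F a + ε * a) := by fun_prop
    simpa using (this.tendsto 0).mono_left nhdsWithin_le_nhds
  have := ge_of_tendsto h0 (b := 0) (by
    filter_upwards [self_mem_nhdsWithin] with ε hε
    linarith [key ε hε])
  linarith

/-! ### The Laplace integral on compact intervals. -/

lemma IsLaplaceMajor.add {f g U W : ℝ → ℝ} (hU : Continuous U) (hW : Continuous W) {a b : ℝ}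
    (h : IsLaplaceMajor f a b U) (h' : IsLaplaceMajor g a b W) :
    IsLaplaceMajor (fun x => f x + g x) a b (fun x => U x + W x) := by
  rw [isLaplaceMajor_iff_of_continuous hU] at h
  rw [isLaplaceMajor_iff_of_continuous hW] at h'
  have hc : Continuous fun x => U x + W x := hU.add hW
  rw [isLaplaceMajor_iff_of_continuous hc]
  refine ⟨fun x hx => (h.1 x hx).add hU hW (h'.1 x hx), fun x hx => ?_⟩
  have := (h.2 x hx).add hU.negReflect hW.negReflect (h'.2 x hx)
  refine cast (congrArg (fun F => LowerLaplaceRightGE F (-x) (f x + g x)) ?_) this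
  funext z
  simp only [_root_.negReflect]
  ring

lemma IsLaplaceMinor.add {f g U W : ℝ → ℝ} (hU : Continuous U) (hW : Continuous W) {a b : ℝ}
    (h : IsLaplaceMinor f a b U) (h' : IsLaplaceMinor g a b W) :
    IsLaplaceMinor (fun x => f x + g x) a b (fun x => U x + W x) := by
  rw [isLaplaceMinor_iff] at h h' ⊢
  have hU' : Continuous fun x => -U x := hU.neg
  have hW' : Continuous fun x => -W x := hW.neg
  simpa only [neg_add] using h.add hU' hW' h'

lemma IsLaplaceMajor.mono {f U : ℝ → ℝ} (hU : Continuous U) {a b c d : ℝ}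
    (h : IsLaplaceMajor f a b U) (hac : a ≤ c) (hdb : d ≤ b) : IsLaplaceMajor f c d U := by
  rw [isLaplaceMajor_iff_of_continuous hU] at h ⊢
  exact ⟨fun x hx => h.1 x ⟨hac.trans hx.1, hx.2.trans_le hdb⟩,
    fun x hx => h.2 x ⟨hac.trans_lt hx.1, hx.2.trans hdb⟩⟩

lemma IsLaplaceMinor.mono {f U : ℝ → ℝ} (hU : Continuous U) {a b c d : ℝ}
    (h : IsLaplaceMinor f a b U) (hac : a ≤ c) (hdb : d ≤ b) : IsLaplaceMinor f c d U :=
  isLaplaceMinor_iff.2 ((isLaplaceMinor_iff.1 h).mono hU.neg hac hdb)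

lemma IsLaplaceMinor.exists_continuous {f U : ℝ → ℝ} {a b : ℝ} (hab : a ≤ b)
    (h : IsLaplaceMinor f a b U) :
    ∃ W, Continuous W ∧ IsLaplaceMinor f a b W ∧ EqOn W U (Icc a b) := by
  obtain ⟨W, h1, h2, h3⟩ := (isLaplaceMinor_iff.1 h).exists_continuous hab
  refine ⟨fun x => -W x, h1.neg, isLaplaceMinor_iff.2 (by simpa using h2), fun x hx => ?_⟩
  simp [h3 hx]

/-- The difference of a major and a minor function is nondecreasing. -/
lemma IsLaplaceMajor.sub_minor_le {f U V : ℝ → ℝ} (hU : Continuous U) (hV : Continuous V)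
    {a b : ℝ} (hM : IsLaplaceMajor f a b U) (hm : IsLaplaceMinor f a b V) {c d : ℝ} (hac : a ≤ c)
    (hcd : c ≤ d) (hdb : d ≤ b) : U c - V c ≤ U d - V d := by
  have hV' : Continuous fun x => -V x := hV.neg
  have hUV : Continuous fun x => U x + -V x := hU.add hV'
  have h := hM.add hU hV' (isLaplaceMinor_iff.1 hm)
  simp only [add_neg_cancel] at h
  refine le_of_lowerLaplaceRightGE_zero (F := fun x => U x - V x) (hU.sub hV) hcd fun x hx => ?_
  simpa [sub_eq_add_neg] using ((isLaplaceMajor_iff_of_continuous hUV).1 h).1 x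
    ⟨hac.trans hx.1, hx.2.trans_le hdb⟩

/-- A Cauchy criterion that names no value of the integral and provides functions continuous on the
whole line. Subintervals, sums and products are all treated through it. -/
lemma laplaceIntegrableOn_iff {f : ℝ → ℝ} {a b : ℝ} :
    LaplaceIntegrableOn f a b ↔ a ≤ b ∧ ∀ ε > 0, ∃ U V, Continuous U ∧ Continuous V ∧
      IsLaplaceMajor f a b U ∧ IsLaplaceMinor f a b V ∧ (U b - U a) - (V b - V a) < ε := by
  constructor
  · rintro ⟨A, hab, hA, hA'⟩
    refine ⟨hab, fun ε hε => ?_⟩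
    obtain ⟨_, ⟨U, hU, rfl⟩, -, hU'⟩ := hA.exists_between (show A < A + ε / 2 by linarith)
    obtain ⟨_, ⟨V, hV, rfl⟩, hV', -⟩ := hA'.exists_between (show A - ε / 2 < A by linarith)
    obtain ⟨U₁, h1, h2, h3⟩ := hU.exists_continuous hab
    obtain ⟨V₁, h4, h5, h6⟩ := hV.exists_continuous hab
    refine ⟨U₁, V₁, h1, h4, h2, h5, ?_⟩
    rw [h3 ⟨hab, le_rfl⟩, h3 ⟨le_rfl, hab⟩, h6 ⟨hab, le_rfl⟩, h6 ⟨le_rfl, hab⟩]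
    linarith
  · rintro ⟨hab, h⟩
    have key : ∀ U V, IsLaplaceMajor f a b U → IsLaplaceMinor f a b V → V b - V a ≤ U b - U a := by
      intro U V hU hV
      obtain ⟨U₁, h1, h2, h3⟩ := hU.exists_continuous hab
      obtain ⟨V₁, h4, h5, h6⟩ := hV.exists_continuous hab
      have := h2.sub_minor_le h1 h4 h5 le_rfl hab le_rfl
      rw [h3 ⟨hab, le_rfl⟩, h3 ⟨le_rfl, hab⟩, h6 ⟨hab, le_rfl⟩, h6 ⟨le_rfl, hab⟩] at this
      linarith
    obtain ⟨U₀, V₀, -, -, hU₀, hV₀, -⟩ := h 1 one_pos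
    have hglb : IsGLB {r | ∃ U, IsLaplaceMajor f a b U ∧ r = U b - U a}
        (sInf {r | ∃ U, IsLaplaceMajor f a b U ∧ r = U b - U a}) := by
      refine isGLB_csInf ⟨_, U₀, hU₀, rfl⟩ ⟨V₀ b - V₀ a, ?_⟩
      rintro _ ⟨U, hU, rfl⟩
      exact key U V₀ hU hV₀
    refine ⟨_, hab, hglb, ?_, ?_⟩
    · rintro _ ⟨V, hV, rfl⟩
      refine hglb.2 ?_
      rintro _ ⟨U, hU, rfl⟩
      exact key U V hU hV
    · intro z hz
      refine le_of_forall_pos_le_add fun ε hε => ?_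
      obtain ⟨U, V, -, -, hU, hV, hUV⟩ := h ε hε
      have h1 := hglb.1 ⟨U, hU, rfl⟩
      have h2 := hz ⟨V, hV, rfl⟩
      linarith

lemma LaplaceIntegrableOn.mono {f : ℝ → ℝ} {a b c d : ℝ} (h : LaplaceIntegrableOn f a b)
    (hac : a ≤ c) (hcd : c ≤ d) (hdb : d ≤ b) : LaplaceIntegrableOn f c d := by
  rw [laplaceIntegrableOn_iff] at h ⊢
  refine ⟨hcd, fun ε hε => ?_⟩
  obtain ⟨U, V, hU, hV, hM, hm, hUV⟩ := h.2 ε hε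
  refine ⟨U, V, hU, hV, hM.mono hU hac hdb, hm.mono hV hac hdb, ?_⟩
  -- Since `U - V` is nondecreasing, its increment over `[c, d]` is at most the one over `[a, b]`.
  have h1 := hM.sub_minor_le hU hV hm le_rfl hac (hcd.trans hdb)
  have h2 := hM.sub_minor_le hU hV hm (hac.trans hcd) hdb le_rfl
  linarith

lemma LaplaceIntegrableOn.add {f g : ℝ → ℝ} {a b : ℝ} (h : LaplaceIntegrableOn f a b)
    (h' : LaplaceIntegrableOn g a b) : LaplaceIntegrableOn (fun x => f x + g x) a b := by
  rw [laplaceIntegrableOn_iff] at h h' ⊢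
  refine ⟨h.1, fun ε hε => ?_⟩
  obtain ⟨U, V, hU, hV, hM, hm, hUV⟩ := h.2 (ε / 2) (by linarith)
  obtain ⟨U', V', hU', hV', hM', hm', hUV'⟩ := h'.2 (ε / 2) (by linarith)
  exact ⟨_, _, hU.add hU', hV.add hV', hM.add hU hU' hM', hm.add hV hV' hm', by
    simp only [Pi.add_apply]; linarith⟩

lemma HasLaplaceIntegralOn.neg {f : ℝ → ℝ} {a b A : ℝ} (h : HasLaplaceIntegralOn f a b A) :
    HasLaplaceIntegralOn (fun x => -f x) a b (-A) := by
  obtain ⟨hab, h1, h2⟩ := h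
  refine ⟨hab, ?_, ?_⟩
  · refine cast (congrArg (fun S => IsGLB S (-A)) (Set.ext fun r => ?_)) h2.neg
    refine Iff.symm ?_
    constructor
    · rintro ⟨U, hU, rfl⟩
      refine ⟨fun x => -U x, isLaplaceMinor_iff.2 (by simpa using hU), by ring⟩
    · rintro ⟨V, hV, hr⟩
      exact ⟨fun x => -V x, isLaplaceMinor_iff.1 hV, by linarith⟩
  · refine cast (congrArg (fun S => IsLUB S (-A)) (Set.ext fun r => ?_)) h1.neg
    refine Iff.symm ?_
    constructor
    · rintro ⟨V, hV, rfl⟩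
      exact ⟨fun x => -V x, by simpa using isLaplaceMinor_iff.1 hV, by ring⟩
    · rintro ⟨U, hU, hr⟩
      exact ⟨fun x => -U x, isLaplaceMajor_neg_iff.1 hU, by linarith⟩

lemma LaplaceIntegrableOn.neg {f : ℝ → ℝ} {a b : ℝ} (h : LaplaceIntegrableOn f a b) :
    LaplaceIntegrableOn (fun x => -f x) a b :=
  h.imp' _ fun _ hA => hA.neg

lemma HasLaplaceIntegralOn.comp_neg {f : ℝ → ℝ} {a b A : ℝ} (h : HasLaplaceIntegralOn f a b A) :
    HasLaplaceIntegralOn (fun x => f (-x)) (-b) (-a) A := by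
  obtain ⟨hab, h1, h2⟩ := h
  refine ⟨by linarith, ?_, ?_⟩
  · convert h1 using 1
    ext r
    constructor
    · rintro ⟨U, hU, rfl⟩
      exact ⟨_, by simpa using hU.negReflect, by simp only [negReflect]; ring⟩
    · rintro ⟨U, hU, rfl⟩
      exact ⟨_, hU.negReflect, by simp only [negReflect, neg_neg]; ring⟩
  · convert h2 using 1
    ext r
    constructor
    · rintro ⟨U, hU, rfl⟩
      exact ⟨_, by simpa using hU.negReflect, by simp only [negReflect]; ring⟩
    · rintro ⟨U, hU, rfl⟩
      exact ⟨_, hU.negReflect, by simp only [negReflect, neg_neg]; ring⟩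

lemma HasLaplaceIntegralOn.add_adjacent {f : ℝ → ℝ} {a b c A B C : ℝ}
    (h₁ : HasLaplaceIntegralOn f a b A) (h₂ : HasLaplaceIntegralOn f b c B)
    (h : HasLaplaceIntegralOn f a c C) : C = A + B := by
  -- Restricting a major function of `[a, c]` to the two parts gives one inequality; `-f` gives the
  -- other.
  have key : ∀ {f : ℝ → ℝ} {A B C : ℝ}, HasLaplaceIntegralOn f a b A →
      HasLaplaceIntegralOn f b c B → HasLaplaceIntegralOn f a c C → A + B ≤ C := by
    intro f A B C h₁ h₂ h
    refine le_of_forall_pos_le_add fun ε hε => ?_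
    obtain ⟨_, ⟨U, hU, rfl⟩, -, hU'⟩ := h.2.1.exists_between (show C < C + ε by linarith)
    obtain ⟨W, hW, hM, e⟩ := hU.exists_continuous h.1
    have h3 := h₁.2.1.1 ⟨W, hM.mono hW le_rfl h₂.1, rfl⟩
    have h4 := h₂.2.1.1 ⟨W, hM.mono hW h₁.1 le_rfl, rfl⟩
    rw [← e ⟨h.1, le_rfl⟩, ← e ⟨le_rfl, h.1⟩] at hU'
    linarith
  have h5 := key h₁ h₂ h
  have h6 := key h₁.neg h₂.neg h.neg
  linarith

/-! ### Multiplication by `C¹` functions through integration by parts. -/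

/-- The factor `g z - g x` vanishes at `x`, so continuity of `U` is enough. -/
lemma hasDerivAt_mul_sub_of_continuous {U g : ℝ → ℝ} (hU : Continuous U) {x g' : ℝ}
    (hg : HasDerivAt g g' x) : HasDerivAt (fun z => U z * (g z - g x)) (U x * g') x := by
  rw [hasDerivAt_iff_tendsto_slope] at hg ⊢
  refine (((hU.tendsto x).mono_left nhdsWithin_le_nhds).mul hg).congr fun z => ?_
  simp only [slope_def_field, sub_self, mul_zero, sub_zero]
  ring

/-- The function splits as `g x * U z` plus `U z * (g z - g x) - ∫ U g'`, and the second summand has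
derivative `0` at `x`. Positivity of `g x` preserves the direction of the inequality. -/
lemma LowerLaplaceRightGE.mul_sub_integral {U g g' : ℝ → ℝ} (hU : Continuous U)
    (hg : ∀ z, HasDerivAt g (g' z) z) (hg' : Continuous g') (p : ℝ) {x c : ℝ} (hx : 0 < g x)
    (h : LowerLaplaceRightGE U x c) :
    LowerLaplaceRightGE (fun z => U z * g z - ∫ t in p..z, U t * g' t) x (c * g x) := by
  have hgc : Continuous g := continuous_iff_continuousAt.2 fun z => (hg z).continuousAt
  have hi : ∀ z, HasDerivAt (fun z => ∫ t in p..z, U t * g' t) (U z * g' z) z := fun z =>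
    (hU.mul hg').integral_hasStrictDerivAt p z |>.hasDerivAt
  have hic : Continuous (fun z => ∫ t in p..z, U t * g' t) :=
    continuous_iff_continuousAt.2 fun z => (hi z).continuousAt
  have h1 := (hasDerivAt_mul_sub_of_continuous hU (hg x)).sub (hi x)
  rw [sub_self] at h1
  have hRc : Continuous (fun z => U z * (g z - g x) - ∫ t in p..z, U t * g' t) :=
    (hU.mul (hgc.sub continuous_const)).sub hic
  have h2 := lowerLaplaceRightGE_of_hasDerivWithinAt hRc h1.hasDerivWithinAt
  have hUc : Continuous fun z => g x * U z := continuous_const.mul hU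
  have h3 := (h.const_mul hx).add hUc hRc h2
  rw [add_zero, mul_comm (g x) c] at h3
  refine cast (congrArg (fun F => LowerLaplaceRightGE F x (c * g x)) ?_) h3
  funext z
  ring

/-- Integration by parts turns a major function of `f` into one of `f * g`. -/
lemma IsLaplaceMajor.mul_sub_integral {f U g g' : ℝ → ℝ} (hU : Continuous U)
    (hg : ∀ z, HasDerivAt g (g' z) z) (hg' : Continuous g') (hpos : ∀ z, 0 < g z) {a b : ℝ}
    (h : IsLaplaceMajor f a b U) :
    IsLaplaceMajor (fun x => f x * g x) a b (fun z => U z * g z - ∫ t in a..z, U t * g' t) := by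
  have hgc : Continuous g := continuous_iff_continuousAt.2 fun z => (hg z).continuousAt
  have hic : Continuous (fun z => ∫ t in a..z, U t * g' t) :=
    intervalIntegral.continuous_primitive (fun _ _ => (hU.mul hg').intervalIntegrable _ _) _
  rw [isLaplaceMajor_iff_of_continuous hU] at h
  have hc : Continuous fun z => U z * g z - ∫ t in a..z, U t * g' t := (hU.mul hgc).sub hic
  rw [isLaplaceMajor_iff_of_continuous hc]
  refine ⟨fun x hx => (h.1 x hx).mul_sub_integral hU hg hg' a (hpos x), fun x hx => ?_⟩
  have h1 := (h.2 x hx).mul_sub_integral hU.negReflect (g := fun z => g (-z))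
    (g' := fun z => -g' (-z)) (fun z => by simpa [Function.comp_def] using HasDerivAt.comp z (hg (-z)) (hasDerivAt_neg z))
    (hg'.comp continuous_neg).neg (-a) (hpos _)
  simp only [neg_neg] at h1
  refine cast (congrArg (fun F => LowerLaplaceRightGE F (-x) (f x * g x)) ?_) h1
  funext z
  have := intervalIntegral.integral_comp_neg (a := -a) (b := z) (fun t => U t * g' t)
  rw [neg_neg] at this
  simp only [_root_.negReflect, neg_mul_neg]
  rw [this, intervalIntegral.integral_symm]
  ring

lemma LaplaceIntegrableOn.mul_of_pos {f g g' : ℝ → ℝ} (hg : ∀ z, HasDerivAt g (g' z) z)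
    (hg' : Continuous g') (hpos : ∀ z, 0 < g z) {a b : ℝ} (h : LaplaceIntegrableOn f a b) :
    LaplaceIntegrableOn (fun x => f x * g x) a b := by
  rw [laplaceIntegrableOn_iff] at h ⊢
  obtain ⟨hab, h⟩ := h
  refine ⟨hab, fun ε hε => ?_⟩
  obtain ⟨M, hM⟩ := isCompact_Icc.exists_bound_of_continuousOn (hg'.continuousOn (s := Icc a b))
  have hM0 : 0 ≤ M := (norm_nonneg _).trans (hM a ⟨le_rfl, hab⟩)
  have hK : 0 < g b + M * (b - a) :=
    add_pos_of_pos_of_nonneg (hpos b) (mul_nonneg hM0 (sub_nonneg.2 hab))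
  obtain ⟨U, V, hU, hV, hMaj, hmin, hUV⟩ := h (ε / (g b + M * (b - a))) (div_pos hε hK)
  have hVm : IsLaplaceMinor (fun x => f x * g x) a b
      (fun z => V z * g z - ∫ t in a..z, V t * g' t) := by
    rw [isLaplaceMinor_iff] at hmin ⊢
    have hV' : Continuous fun x => -V x := hV.neg
    have := hmin.mul_sub_integral hV' hg hg' hpos
    simp only [neg_mul, intervalIntegral.integral_neg, sub_neg_eq_add] at this
    simpa only [neg_sub', sub_neg_eq_add] using this
  have hgc : Continuous g := continuous_iff_continuousAt.2 fun z => (hg z).continuousAt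
  refine ⟨_, _, ?_, ?_, hMaj.mul_sub_integral hU hg hg' hpos, hVm, ?_⟩
  · exact (hU.mul hgc).sub (intervalIntegral.continuous_primitive
      (fun _ _ => (hU.mul hg').intervalIntegrable _ _) _)
  · exact (hV.mul hgc).sub (intervalIntegral.continuous_primitive
      (fun _ _ => (hV.mul hg').intervalIntegrable _ _) _)
  simp only [intervalIntegral.integral_same, sub_zero]
  -- The increment to be bounded equals `D b * g b - ∫ D g'`. As `0 ≤ D ≤ D b` on `[a, b]`, it is at
  -- most `D b * (g b + M * (b - a))`, which explains the denominator chosen above.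
  set D : ℝ → ℝ := fun z => (U z - V z) - (U a - V a) with hD
  have hDc : Continuous D := by fun_prop
  have hD0 : ∀ z ∈ Icc a b, |D z| ≤ D b := fun z hz => by
    have h1 := hMaj.sub_minor_le hU hV hmin le_rfl hz.1 hz.2
    have h2 := hMaj.sub_minor_le hU hV hmin hz.1 hz.2 le_rfl
    rw [abs_of_nonneg] <;> simp only [hD] <;> linarith
  have hg'i : ∫ t in a..b, g' t = g b - g a :=
    intervalIntegral.integral_eq_sub_of_hasDerivAt (fun t _ => hg t) (hg'.intervalIntegrable _ _)
  have e1 : ∫ t in a..b, D t * g' t = (∫ t in a..b, U t * g' t) - (∫ t in a..b, V t * g' t) -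
      (U a - V a) * (g b - g a) := by
    rw [← hg'i, ← intervalIntegral.integral_const_mul, ← intervalIntegral.integral_sub,
      ← intervalIntegral.integral_sub]
    · refine intervalIntegral.integral_congr fun t _ => ?_
      simp only [hD]
      ring
    all_goals exact Continuous.intervalIntegrable (by fun_prop) _ _
  have e2 : ‖∫ t in a..b, D t * g' t‖ ≤ D b * M * |b - a| := by
    refine intervalIntegral.norm_integral_le_of_norm_le_const fun t ht => ?_
    rw [uIoc_of_le hab] at ht
    have ht' : t ∈ Icc a b := ⟨ht.1.le, ht.2⟩
    rw [norm_mul]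
    exact mul_le_mul (hD0 t ht') (hM t ht') (norm_nonneg _)
      ((abs_nonneg _).trans (hD0 t ht'))
  rw [abs_of_nonneg (sub_nonneg.2 hab)] at e2
  have e3 := (abs_le.1 e2).1
  have e4 : D b < ε / (g b + M * (b - a)) := by
    simp only [hD]
    linarith
  rw [lt_div_iff₀ hK] at e4
  have e5 : D b = (U b - V b) - (U a - V a) := rfl
  nlinarith

/-- A Laplace integrable function stays so after multiplication by a bounded `C¹` function. -/
lemma LaplaceIntegrableOn.mul_of_bounded {f g g' : ℝ → ℝ} (hg : ∀ z, HasDerivAt g (g' z) z)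
    (hg' : Continuous g') {M : ℝ} (hM : ∀ z, |g z| ≤ M) {a b : ℝ} (h : LaplaceIntegrableOn f a b) :
    LaplaceIntegrableOn (fun x => f x * g x) a b := by
  have hM0 : 0 ≤ M := (abs_nonneg _).trans (hM 0)
  -- Only positive factors are available, so `g` is written as `g + (M + 1)` minus the constant `M +
  -- 1`.
  have h1 := h.mul_of_pos (g := fun z => g z + (M + 1)) (fun z => (hg z).add_const _) hg'
    fun z => by linarith [(abs_le.1 (hM z)).1]
  have h2 := h.mul_of_pos (g := fun _ => M + 1) (fun z => hasDerivAt_const z _) continuous_const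
    fun z => by linarith
  have h3 := h1.add h2.neg
  refine cast (congrArg (fun F => LaplaceIntegrableOn F a b) ?_) h3
  funext z
  ring

/-! ### Agreement with the Lebesgue integral. -/

/-- The Vitali–Carathéodory theorem provides major functions of Lebesgue integrable functions. -/
lemma exists_isLaplaceMajor_of_intervalIntegrable {f : ℝ → ℝ} {a b : ℝ} (hab : a ≤ b)
    (hf : IntervalIntegrable f volume a b) {ε : ℝ} (hε : 0 < ε) :
    ∃ U, IsLaplaceMajor f a b U ∧ U b - U a < (∫ x in a..b, f x) + ε := by
  have hfi : Integrable f (volume.restrict (Ioc a b)) :=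
    (intervalIntegrable_iff_integrableOn_Ioc_of_le hab).1 hf
  have hIcc := integrableOn_Icc_iff_integrableOn_Ioc (f := f) (μ := volume) (a := a) (b := b)
  obtain ⟨g, hfg, hlsc, hgi, hgt, hgε⟩ := exists_lt_lowerSemicontinuous_integral_lt
    ((Icc a b).indicator f) ((hIcc.2 hfi).integrable_indicator measurableSet_Icc) hε
  set G : ℝ → ℝ := fun x => (g x).toReal with hG
  set U : ℝ → ℝ := fun x => ∫ t in a..x, G t with hU
  have hii : ∀ c d, IntervalIntegrable G volume c d := fun c d => hgi.intervalIntegrable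
  have hUc : Continuous U := intervalIntegral.continuous_primitive hii a
  -- Since `f x < g x`, lower semicontinuity keeps `g` above the number `f x` near `x`; integrating
  -- gives the bound on increments.
  have hloc : ∀ x ∈ Icc a b, ∃ η > 0, ∀ c d, x - η < c → c ≤ d → d < x + η →
      f x * (d - c) ≤ U d - U c := by
    intro x hx
    have h1 := hlsc x (f x) (by simpa [hx] using hfg x)
    obtain ⟨η, hη, h1⟩ := Metric.eventually_nhds_iff.1 h1
    refine ⟨η, hη, fun c d hc hcd hd => ?_⟩
    have e : U d - U c = ∫ t in c..d, G t := by
      simp only [hU]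
      rw [intervalIntegral.integral_interval_sub_left (hii _ _) (hii _ _)]
    have e2 : f x * (d - c) = ∫ t in c..d, f x := by simp [mul_comm]
    rw [e, e2]
    refine intervalIntegral.integral_mono_ae_restrict hcd (by simp) (hii _ _) ?_
    filter_upwards [ae_restrict_of_ae hgt, ae_restrict_mem measurableSet_Icc] with t ht htc
    have h2 : (f x : EReal) < g t := h1 (show dist t x < η by
      rw [Real.dist_eq, abs_lt]; constructor <;> linarith [htc.1, htc.2])
    have h3 : ((g t).toReal : EReal) = g t :=
      EReal.coe_toReal ht.ne (ne_of_gt (lt_of_le_of_lt bot_le h2))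
    rw [← h3] at h2
    exact_mod_cast h2.le
  refine ⟨U, (isLaplaceMajor_iff_of_continuous hUc).2 ⟨fun x hx => ?_, fun x hx => ?_⟩, ?_⟩
  · obtain ⟨η, hη, h⟩ := hloc x ⟨hx.1, hx.2.le⟩
    refine lowerLaplaceRightGE_of_eventually hUc ?_
    filter_upwards [Ioo_mem_nhdsGT hη] with t ht
    simpa using h x (x + t) (by linarith) (by linarith [ht.1]) (by linarith [ht.2])
  · obtain ⟨η, hη, h⟩ := hloc x ⟨hx.1.le, hx.2⟩
    refine lowerLaplaceRightGE_of_eventually hUc.negReflect ?_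
    filter_upwards [Ioo_mem_nhdsGT hη] with t ht
    have h1 := h (x - t) x (by linarith [ht.2]) (by linarith [ht.1]) (by linarith)
    have h2 : -(-x + t) = x - t := by ring
    simp only [negReflect, h2, neg_neg]
    linarith
  · have hind := (hIcc.2 hfi).integrable_indicator measurableSet_Icc
    have h0 : 0 ≤ᵐ[volume] fun x => G x - (Icc a b).indicator f x := by
      filter_upwards [hgt] with t ht
      have h3 : ((g t).toReal : EReal) = g t :=
        EReal.coe_toReal ht.ne (ne_of_gt (lt_of_le_of_lt bot_le (hfg t)))
      have h2 := hfg t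
      rw [← h3] at h2
      exact sub_nonneg.2 (by exact_mod_cast h2.le)
    -- The excess of `G` over `f` is nonnegative, so its integral over `(a, b]` is at most its total
    -- integral, which is less than `ε`.
    have h1 := setIntegral_le_integral (s := Ioc a b) (hgi.sub hind) h0
    simp only [Pi.sub_apply] at h1
    rw [integral_sub hgi.integrableOn hind.integrableOn, integral_sub hgi hind] at h1
    have h4 : ∫ x in Ioc a b, (Icc a b).indicator f x = ∫ x in Ioc a b, f x :=
      setIntegral_congr_fun measurableSet_Ioc fun x hx => indicator_of_mem (Ioc_subset_Icc_self hx) f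
    simp only [hU, intervalIntegral.integral_same, sub_zero]
    rw [intervalIntegral.integral_of_le hab, intervalIntegral.integral_of_le hab]
    linarith

/-- The Laplace integral of a Lebesgue integrable function is its Lebesgue integral. -/
lemma HasLaplaceIntegralOn.eq_intervalIntegral {f : ℝ → ℝ} {a b A : ℝ}
    (h : HasLaplaceIntegralOn f a b A) (hf : IntervalIntegrable f volume a b) :
    A = ∫ x in a..b, f x := by
  have key : ∀ {f : ℝ → ℝ} {A : ℝ}, HasLaplaceIntegralOn f a b A →
      IntervalIntegrable f volume a b → A ≤ ∫ x in a..b, f x := by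
    intro f A h hf
    refine le_of_forall_pos_le_add fun ε hε => ?_
    obtain ⟨U, hU, hlt⟩ := exists_isLaplaceMajor_of_intervalIntegrable h.1 hf hε
    exact (h.2.1.1 ⟨U, hU, rfl⟩).trans hlt.le
  have h1 := key h hf
  have h2 := key h.neg hf.neg
  rw [intervalIntegral.integral_neg] at h2
  linarith

/-! ### Trigonometric factors, integrals over half-lines and the two existence theorems. -/

/-- A bounded `C¹` function which is constant or changes sign under a shift. -/
structure IsHalfPeriodic (g : ℝ → ℝ) : Prop where
  exists_deriv : ∃ g' : ℝ → ℝ, Continuous g' ∧ ∀ z, HasDerivAt g (g' z) z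
  abs_le_one : ∀ z, |g z| ≤ 1
  shift : (∃ k, ∀ z, g z = k) ∨ ∃ h > 0, ∀ z, g (z + h) = -g z

lemma IsHalfPeriodic.continuous {g : ℝ → ℝ} (hg : IsHalfPeriodic g) : Continuous g := by
  obtain ⟨g', -, h⟩ := hg.exists_deriv
  exact continuous_iff_continuousAt.2 fun z => (h z).continuousAt

lemma IsHalfPeriodic.comp_neg {g : ℝ → ℝ} (hg : IsHalfPeriodic g) :
    IsHalfPeriodic fun z => g (-z) := by
  refine ⟨?_, fun z => hg.abs_le_one _, ?_⟩
  · obtain ⟨g', h1, h2⟩ := hg.exists_deriv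
    exact ⟨fun z => -g' (-z), (h1.comp continuous_neg).neg, fun z => by
      simpa [Function.comp_def] using HasDerivAt.comp z (h2 (-z)) (hasDerivAt_neg z)⟩
  · rcases hg.shift with ⟨k, hk⟩ | ⟨h, hh, hs⟩
    · exact Or.inl ⟨k, fun z => hk _⟩
    · refine Or.inr ⟨h, hh, fun z => ?_⟩
      have := hs (-z - h)
      rw [sub_add_cancel] at this
      rw [neg_add, ← sub_eq_add_neg]
      linarith

lemma IsHalfPeriodic.neg {g : ℝ → ℝ} (hg : IsHalfPeriodic g) : IsHalfPeriodic fun z => -g z := by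
  refine ⟨?_, fun z => by simpa using hg.abs_le_one z, ?_⟩
  · obtain ⟨g', h1, h2⟩ := hg.exists_deriv
    exact ⟨fun z => -g' z, h1.neg, fun z => (h2 z).neg⟩
  · rcases hg.shift with ⟨k, hk⟩ | ⟨h, hh, hs⟩
    · exact Or.inl ⟨-k, fun z => by rw [hk]⟩
    · exact Or.inr ⟨h, hh, fun z => by rw [hs]⟩

lemma exists_shift_mul {F : ℝ → ℝ} (hF : ∀ z, F (z + Real.pi) = -F z) (ω : ℝ) :
    (∃ k, ∀ z : ℝ, F (ω * z) = k) ∨ ∃ h > 0, ∀ z, F (ω * (z + h)) = -F (ω * z) := by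
  rcases lt_trichotomy ω 0 with h | rfl | h
  · refine Or.inr ⟨-Real.pi / ω, div_pos_of_neg_of_neg (by linarith [Real.pi_pos]) h, fun z => ?_⟩
    have e : ω * (z + -Real.pi / ω) + Real.pi = ω * z := by
      have := h.ne
      field_simp
      ring
    rw [← e, hF, neg_neg]
  · exact Or.inl ⟨F 0, fun z => by simp⟩
  · refine Or.inr ⟨Real.pi / ω, div_pos Real.pi_pos h, fun z => ?_⟩
    rw [← hF]
    congr 1
    field_simp

lemma isHalfPeriodic_cos (ω : ℝ) : IsHalfPeriodic fun z => Real.cos (ω * z) where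
  exists_deriv := ⟨fun z => -Real.sin (ω * z) * (ω * 1), by fun_prop,
    fun z => ((hasDerivAt_id z).const_mul ω).cos⟩
  abs_le_one z := Real.abs_cos_le_one _
  shift := exists_shift_mul Real.cos_add_pi ω

lemma isHalfPeriodic_sin (ω : ℝ) : IsHalfPeriodic fun z => Real.sin (ω * z) where
  exists_deriv := ⟨fun z => Real.cos (ω * z) * (ω * 1), by fun_prop,
    fun z => ((hasDerivAt_id z).const_mul ω).sin⟩
  abs_le_one z := Real.abs_sin_le_one _
  shift := exists_shift_mul Real.sin_add_pi ω

lemma LaplaceIntegrableOn.mul_halfPeriodic {f g : ℝ → ℝ} (hg : IsHalfPeriodic g) {a b : ℝ}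
    (h : LaplaceIntegrableOn f a b) : LaplaceIntegrableOn (fun x => f x * g x) a b := by
  obtain ⟨g', h1, h2⟩ := hg.exists_deriv
  exact h.mul_of_bounded h2 h1 hg.abs_le_one

/-- A locally Laplace integrable function on `[a, ∞)` which is Lebesgue integrable on bounded
intervals near infinity has a Laplace integral as soon as the Lebesgue integrals converge. -/
lemma exists_hasLaplaceIntegralIci {f : ℝ → ℝ} {a N L : ℝ} (haN : a ≤ N)
    (hf : ∀ c, a ≤ c → LaplaceIntegrableOn f a c)
    (hi : ∀ d, N ≤ d → IntervalIntegrable f volume N d)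
    (hL : Tendsto (fun d => ∫ x in N..d, f x) atTop (𝓝 L)) :
    ∃ A, HasLaplaceIntegralIci f a A := by
  choose! F hF using hf
  refine ⟨F N + L, F, hF, (hL.const_add (F N)).congr' ?_⟩
  filter_upwards [eventually_ge_atTop N] with d hd
  obtain ⟨B, hB⟩ := LaplaceIntegrableOn.mono ⟨_, hF d (haN.trans hd)⟩ haN hd le_rfl
  rw [(hF N haN).add_adjacent hB (hF d (haN.trans hd)), hB.eq_intervalIntegral (hi d hd)]

lemma HasLaplaceIntegralIci.tendsto_intervalIntegral {f : ℝ → ℝ} {a N A : ℝ} (haN : a ≤ N)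
    (hf : HasLaplaceIntegralIci f a A) (hi : ∀ d, N ≤ d → IntervalIntegrable f volume N d) :
    ∃ L, Tendsto (fun d => ∫ x in N..d, f x) atTop (𝓝 L) := by
  obtain ⟨F, hF, hlim⟩ := hf
  refine ⟨A - F N, (hlim.sub_const (F N)).congr' ?_⟩
  filter_upwards [eventually_ge_atTop N] with d hd
  obtain ⟨B, hB⟩ := LaplaceIntegrableOn.mono ⟨_, hF d (haN.trans hd)⟩ haN hd le_rfl
  rw [(hF N haN).add_adjacent hB (hF d (haN.trans hd)), hB.eq_intervalIntegral (hi d hd)]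
  ring

lemma exists_hasLaplaceIntegralIci_mul_of_integrableOn {f g : ℝ → ℝ} (hg : IsHalfPeriodic g)
    {a N : ℝ} (hf : ∀ c, a ≤ c → LaplaceIntegrableOn f a c) (hi : IntegrableOn f (Ici N)) :
    ∃ A, HasLaplaceIntegralIci (fun x => f x * g x) a A := by
  have h1 : IntegrableOn (fun x => f x * g x) (Ici (max a N)) := by
    refine (hi.mono_set (Ici_subset_Ici.2 (le_max_right _ _))).mul_bdd (c := 1)
      hg.continuous.aestronglyMeasurable (ae_of_all _ fun x => hg.abs_le_one x)
  have h2 := h1.mono_set Ioi_subset_Ici_self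
  refine exists_hasLaplaceIntegralIci (le_max_left a N) (fun c hc => (hf c hc).mul_halfPeriodic hg)
    (fun d hd => ?_) (intervalIntegral_tendsto_integral_Ioi _ h2 tendsto_id)
  rw [intervalIntegrable_iff_integrableOn_Ioc_of_le hd]
  exact h2.mono_set Ioc_subset_Ioi_self

lemma tendsto_intervalIntegral_add_zero {u : ℝ → ℝ} (hu : Tendsto u atTop (𝓝 0)) {h : ℝ}
    (hh : 0 ≤ h) : Tendsto (fun d => ∫ x in d..(d + h), u x) atTop (𝓝 0) := by
  rw [Metric.tendsto_atTop] at hu ⊢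
  intro ε hε
  obtain ⟨M, hM⟩ := hu (ε / (h + 1)) (by positivity)
  refine ⟨M, fun d hd => ?_⟩
  rw [dist_zero_right]
  have h1 : ‖∫ x in d..(d + h), u x‖ ≤ ε / (h + 1) * |d + h - d| := by
    refine intervalIntegral.norm_integral_le_of_norm_le_const fun x hx => ?_
    rw [uIoc_of_le (by linarith)] at hx
    simpa using (hM x (hd.trans hx.1.le)).le
  rw [add_sub_cancel_left, abs_of_nonneg hh] at h1
  refine h1.trans_lt ?_
  rw [div_mul_eq_mul_div, div_lt_iff₀ (by linarith)]
  nlinarith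

/-- A function of bounded variation is controlled by a bounded monotone function. -/
lemma BoundedVariationOn.exists_monotoneOn_control {f : ℝ → ℝ} {N : ℝ}
    (hf : BoundedVariationOn f (Ici N)) :
    ∃ (W : ℝ → ℝ) (T : ℝ), MonotoneOn W (Ici N) ∧ (∀ x ∈ Ici N, 0 ≤ W x ∧ W x ≤ T) ∧
      (∀ x y, N ≤ x → x ≤ y → |f x - f y| ≤ W y - W x) ∧
      ∀ c d, N ≤ c → N ≤ d → IntervalIntegrable f volume c d := by
  have hl := hf.locallyBoundedVariationOn
  have hN : N ∈ Ici N := le_refl N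
  refine ⟨variationOnFromTo f (Ici N) N, (eVariationOn f (Ici N)).toReal,
    variationOnFromTo.monotoneOn hl hN, fun x hx => ⟨?_, ?_⟩, fun x y hx hxy => ?_, fun c d hc hd => ?_⟩
  · exact variationOnFromTo.nonneg_of_le _ _ hx
  · rw [variationOnFromTo.eq_of_le _ _ hx]
    exact ENNReal.toReal_mono hf (eVariationOn.mono _ inter_subset_left)
  · have h1 := variationOnFromTo.add hl hN (show x ∈ Ici N from hx)
      (show y ∈ Ici N from hx.trans hxy)
    rw [← h1, add_sub_cancel_left, variationOnFromTo.eq_of_le _ _ hxy, ← Real.dist_eq]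
    exact BoundedVariationOn.dist_le (hf.mono inter_subset_left) ⟨hx, le_rfl, hxy⟩
      ⟨hx.trans hxy, hxy, le_rfl⟩
  · have hsub : uIcc c d ⊆ Ici N := fun z hz => (le_min hc hd).trans hz.1
    have h1 := ((variationOnFromTo.monotoneOn hl hN).mono hsub).intervalIntegrable (μ := volume)
    have h2 := ((variationOnFromTo.sub_self_monotoneOn hl hN).mono hsub).intervalIntegrable
      (μ := volume)
    refine (h1.sub h2).congr_ae (ae_of_all _ fun x => ?_)
    simp

/-- With a bounded monotone control `W`, the integral of `W (x + h) - W x` telescopes to a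
difference of integrals over two intervals of length `h`, hence is at most `h * T` however long the
interval. -/
lemma integrableOn_sub_shift_of_boundedVariationOn {f : ℝ → ℝ} {N h : ℝ}
    (hf : BoundedVariationOn f (Ici N)) (hh : 0 < h) :
    IntegrableOn (fun x => f x - f (x + h)) (Ioi N) := by
  obtain ⟨W, T, hW, hT, hc, hi⟩ := hf.exists_monotoneOn_control
  have hWi : ∀ c d, N ≤ c → N ≤ d → IntervalIntegrable W volume c d := fun c d hc hd =>
    (hW.mono fun z hz => (le_min hc hd).trans hz.1).intervalIntegrable
  have hsh : ∀ {u : ℝ → ℝ}, (∀ c d, N ≤ c → N ≤ d → IntervalIntegrable u volume c d) →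
      ∀ M, N ≤ M → IntervalIntegrable (fun x => u (x + h)) volume N M := by
    intro u hu M hM
    simpa using (hu (N + h) (M + h) (by linarith) (by linarith)).comp_add_right h
  have hDi : ∀ M, N ≤ M → IntervalIntegrable (fun x => f x - f (x + h)) volume N M :=
    fun M hM => (hi N M le_rfl hM).sub (hsh hi M hM)
  refine integrableOn_Ioi_of_intervalIntegral_norm_bounded (l := atTop) (b := fun M : ℝ => max N M)
    (h * T) N (fun M => ?_) (tendsto_atTop_mono (fun M => le_max_right _ _) tendsto_id)
    (Eventually.of_forall fun M => ?_)
  · rw [← intervalIntegrable_iff_integrableOn_Ioc_of_le (le_max_left _ _)]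
    exact hDi _ (le_max_left _ _)
  · set M' := max N M
    have hM' : N ≤ M' := le_max_left _ _
    have h1 : ∫ x in N..M', ‖f x - f (x + h)‖ ≤ ∫ x in N..M', (W (x + h) - W x) := by
      refine intervalIntegral.integral_mono_on hM' (hDi _ hM').norm
        ((hsh hWi M' hM').sub (hWi _ _ le_rfl hM')) fun x hx => ?_
      exact hc x (x + h) hx.1 (by linarith)
    rw [intervalIntegral.integral_sub (hsh hWi M' hM') (hWi _ _ le_rfl hM'),
      intervalIntegral.integral_comp_add_right] at h1
    have e1 := intervalIntegral.integral_add_adjacent_intervals (hWi N (N + h) le_rfl (by linarith))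
      (hWi (N + h) (M' + h) (by linarith) (by linarith))
    have e2 := intervalIntegral.integral_add_adjacent_intervals (hWi N M' le_rfl hM')
      (hWi M' (M' + h) hM' (by linarith))
    have h2 : 0 ≤ ∫ x in N..(N + h), W x :=
      intervalIntegral.integral_nonneg (by linarith) fun x hx => (hT x hx.1).1
    have h3 : ∫ x in M'..(M' + h), W x ≤ ∫ x in M'..(M' + h), T :=
      intervalIntegral.integral_mono_on (by linarith) (hWi _ _ hM' (by linarith)) (by simp)
        fun x hx => (hT x (hM'.trans hx.1)).2
    rw [intervalIntegral.integral_const, add_sub_cancel_left, smul_eq_mul] at h3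
    linarith

/-- A function of bounded variation with convergent integral tends to zero at infinity. -/
lemma tendsto_zero_of_boundedVariationOn {f : ℝ → ℝ} {N L : ℝ}
    (hf : BoundedVariationOn f (Ici N))
    (hL : Tendsto (fun d => ∫ x in N..d, f x) atTop (𝓝 L)) : Tendsto f atTop (𝓝 0) := by
  obtain ⟨W, T, -, -, -, hi⟩ := hf.exists_monotoneOn_control
  obtain ⟨l, hl⟩ := hf.exists_tendsto_atTop
  rw [inf_eq_right.2 (le_principal_iff.2 (Ici_mem_atTop N))] at hl
  have h1 := tendsto_intervalIntegral_add_zero (u := fun x => f x - l)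
    (by simpa using hl.sub_const l) zero_le_one
  have h2 := (hL.comp (tendsto_atTop_add_const_right atTop 1 tendsto_id)).sub hL
  rw [sub_self] at h2
  -- The integral of `f` over `[d, d + 1]` tends to the limit `l` of `f`, and to `0` because the
  -- integral over `[N, d]` converges.
  have h3 : Tendsto (fun _ : ℝ => l) atTop (𝓝 (0 - 0)) := by
    refine (h2.sub h1).congr' ?_
    filter_upwards [eventually_ge_atTop N] with d hd
    have e := intervalIntegral.integral_add_adjacent_intervals (hi N d le_rfl hd)
      (hi d (d + 1) hd (by linarith))
    rw [intervalIntegral.integral_sub (hi d (d + 1) hd (by linarith)) (by simp)]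
    simp only [Function.comp, id, ← e]
    simp
  rw [sub_zero] at h3
  rwa [tendsto_nhds_unique tendsto_const_nhds h3] at hl

/-- Dirichlet's test for a function of bounded variation and a half-periodic factor. -/
lemma exists_tendsto_integral_mul_of_boundedVariationOn {f g : ℝ → ℝ} {N L : ℝ}
    (hg : IsHalfPeriodic g) (hf : BoundedVariationOn f (Ici N))
    (hL : Tendsto (fun d => ∫ x in N..d, f x) atTop (𝓝 L)) :
    ∃ L', Tendsto (fun d => ∫ x in N..d, f x * g x) atTop (𝓝 L') := by
  rcases hg.shift with ⟨k, hk⟩ | ⟨h, hh, hs⟩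
  · exact ⟨L * k, by simpa only [hk, intervalIntegral.integral_mul_const] using hL.mul_const k⟩
  have h0 := tendsto_zero_of_boundedVariationOn hf hL
  have hD : IntegrableOn (fun x => (f x - f (x + h)) * g x) (Ioi N) :=
    (integrableOn_sub_shift_of_boundedVariationOn hf hh).mul_bdd (c := 1)
      hg.continuous.aestronglyMeasurable (ae_of_all _ fun x => hg.abs_le_one x)
  obtain ⟨W, T, -, -, -, hi'⟩ := hf.exists_monotoneOn_control
  have hi : ∀ c d, N ≤ c → N ≤ d → IntervalIntegrable (fun x => f x * g x) volume c d :=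
    fun c d hc hd => (hi' c d hc hd).mul_continuousOn hg.continuous.continuousOn
  have h1 := intervalIntegral_tendsto_integral_Ioi N hD tendsto_id
  have h2 : Tendsto (fun d => ∫ x in d..(d + h), f x * g x) atTop (𝓝 0) := by
    refine tendsto_intervalIntegral_add_zero ?_ hh.le
    refine squeeze_zero_norm (fun x => ?_) (tendsto_norm_zero.comp h0)
    rw [norm_mul]
    exact mul_le_of_le_one_right (norm_nonneg _) (hg.abs_le_one x)
  -- As `g (x + h) = -g x`, twice the integral of `f g` over `[N, d]` is the integral of `(f x - f
  -- (x + h)) * g x` over `[N, d]`, plus that of `f g` over `[N, N + h]`, minus that over `[d, d +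
  -- h]`.
  refine ⟨_, (((h1.add_const (∫ x in N..(N + h), f x * g x)).sub h2).div_const 2).congr' ?_⟩
  filter_upwards [eventually_ge_atTop N] with d hd
  have hsi : IntervalIntegrable (fun x => f (x + h) * g (x + h)) volume N d := by
    simpa using (hi (N + h) (d + h) (by linarith) (by linarith)).comp_add_right h
  have e : ∫ x in N..d, (f x - f (x + h)) * g x =
      (∫ x in N..d, f x * g x) + ∫ x in (N + h)..(d + h), f x * g x := by
    rw [← intervalIntegral.integral_comp_add_right (fun x => f x * g x),
      ← intervalIntegral.integral_add (hi N d le_rfl hd) hsi]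
    refine intervalIntegral.integral_congr fun x _ => ?_
    simp only [hs]
    ring
  have e1 := intervalIntegral.integral_add_adjacent_intervals (hi N (N + h) le_rfl (by linarith))
    (hi (N + h) (d + h) (by linarith) (by linarith))
  have e2 := intervalIntegral.integral_add_adjacent_intervals (hi N d le_rfl hd)
    (hi d (d + h) hd (by linarith))
  simp only [id]
  rw [e]
  linarith

lemma exists_hasLaplaceIntegralIci_mul_of_boundedVariationOn {f g : ℝ → ℝ}
    (hg : IsHalfPeriodic g) {a N C : ℝ} (hf : HasLaplaceIntegralIci f a C)
    (hbv : BoundedVariationOn f (Ici N)) :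
    ∃ A, HasLaplaceIntegralIci (fun x => f x * g x) a A := by
  have hbv' := hbv.mono (Ici_subset_Ici.2 (le_max_right a N))
  obtain ⟨W, T, -, -, -, hi⟩ := hbv'.exists_monotoneOn_control
  obtain ⟨L, hL⟩ := hf.tendsto_intervalIntegral (le_max_left a N) fun d hd => hi _ d le_rfl hd
  obtain ⟨L', hL'⟩ := exists_tendsto_integral_mul_of_boundedVariationOn hg hbv' hL
  obtain ⟨F, hF, -⟩ := hf
  refine exists_hasLaplaceIntegralIci (le_max_left a N)
    (fun c hc => LaplaceIntegrableOn.mul_halfPeriodic hg ⟨_, hF c hc⟩) (fun d hd => ?_) hL'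
  exact (hi _ d le_rfl hd).mul_continuousOn hg.continuous.continuousOn

lemma hasLaplaceIntegralIic_iff {f : ℝ → ℝ} {b A : ℝ} :
    HasLaplaceIntegralIic f b A ↔ HasLaplaceIntegralIci (fun x => f (-x)) (-b) A := by
  constructor
  · rintro ⟨F, hF, hlim⟩
    refine ⟨fun c => F (-c), fun c hc => ?_, hlim.comp tendsto_neg_atTop_atBot⟩
    simpa using (hF (-c) (by linarith)).comp_neg
  · rintro ⟨F, hF, hlim⟩
    refine ⟨fun c => F (-c), fun c hc => ?_, hlim.comp tendsto_neg_atBot_atTop⟩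
    simpa using (hF (-c) (by linarith)).comp_neg

lemma laplaceFourierExistsAt_of_forall_halfPeriodic {f : ℝ → ℝ}
    (h : ∀ g, IsHalfPeriodic g → LaplaceIntegrable fun x => f x * g x) (y : ℝ) :
    LaplaceFourierExistsAt f y := by
  have e : ∀ x : ℝ, Complex.exp (-2 * Real.pi * Complex.I * y * x) =
      (Real.cos (2 * Real.pi * y * x) : ℂ) - Real.sin (2 * Real.pi * y * x) * Complex.I := by
    intro x
    have : (-2 * Real.pi * Complex.I * y * x : ℂ) = ((-(2 * Real.pi * y * x) : ℝ) : ℂ) * Complex.I := by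
      push_cast; ring
    rw [this, Complex.exp_mul_I, ← Complex.ofReal_cos, ← Complex.ofReal_sin, Real.cos_neg,
      Real.sin_neg]
    push_cast; ring
  obtain ⟨A, hA⟩ := h _ (isHalfPeriodic_cos (2 * Real.pi * y))
  obtain ⟨B, hB⟩ := h _ (isHalfPeriodic_sin (2 * Real.pi * y)).neg
  refine ⟨⟨A, B⟩, ?_, ?_⟩
  · simp only [e]
    convert hA using 2 with x
    simp [-Complex.ofReal_cos, -Complex.ofReal_sin]
  · simp only [e]
    convert hB using 2 with x
    simp [-Complex.ofReal_cos, -Complex.ofReal_sin]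

/-- The Fourier transform of a locally Laplace integrable function which is Lebesgue integrable near
infinity exists everywhere. -/
theorem laplaceFourierExistsAt_of_lebesgueIntegrableNearInfty {f : ℝ → ℝ}
    (hf : LocallyLaplaceIntegrable f) (hi : LebesgueIntegrableNearInfty f) (y : ℝ) :
    LaplaceFourierExistsAt f y := by
  refine laplaceFourierExistsAt_of_forall_halfPeriodic (fun g hg => ?_) y
  obtain ⟨a, ha⟩ := hi
  have h1 : IntegrableOn f (Ici a) := ha.mono_set fun x hx hx' => hx'.2.not_ge hx
  have h2 : IntegrableOn (fun x => f (-x)) (Ici a) := by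
    have h3 : IntegrableOn f (Iic (-a)) := ha.mono_set fun x hx hx' => hx'.1.not_ge hx
    simpa using h3.comp_neg
  obtain ⟨C, hC⟩ := exists_hasLaplaceIntegralIci_mul_of_integrableOn hg (hf 0) h1
  -- The base point `-0` matches `-b` in `hasLaplaceIntegralIic_iff` at `b = 0`.
  obtain ⟨B, hB⟩ := exists_hasLaplaceIntegralIci_mul_of_integrableOn hg.comp_neg (a := -0)
    (fun c hc => (hf (-c) 0 (by linarith)).imp fun _ h => by simpa using h.comp_neg) h2
  exact ⟨B + C, 0, B, C, hasLaplaceIntegralIic_iff.2 hB, hC, rfl⟩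

/-- The Fourier transform of a Laplace integrable function of bounded variation near infinity exists
everywhere. -/
theorem laplaceFourierExistsAt_of_boundedVariationNearInfty {f : ℝ → ℝ}
    (hf : LaplaceIntegrable f) (hbv : BoundedVariationNearInfty f) (y : ℝ) :
    LaplaceFourierExistsAt f y := by
  refine laplaceFourierExistsAt_of_forall_halfPeriodic (fun g hg => ?_) y
  obtain ⟨a, ha⟩ := hbv
  obtain ⟨-, p, B₀, C₀, hB₀, hC₀, -⟩ := hf
  have h1 : BoundedVariationOn f (Ici a) := ha.mono fun x hx hx' => hx'.2.not_ge hx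
  have h2 : BoundedVariationOn (fun x => f (-x)) (Ici a) := by
    have := eVariationOn.comp_le_of_antitoneOn f (s := (Ioo (-a) a)ᶜ) (t := Ici a) (fun x : ℝ => -x)
      (fun x _ y _ hxy => neg_le_neg hxy)
      fun x hx hx' => absurd hx'.1 (not_lt.2 (neg_le_neg hx))
    exact ne_top_of_le_ne_top ha this
  obtain ⟨C, hC⟩ := exists_hasLaplaceIntegralIci_mul_of_boundedVariationOn hg hC₀ h1
  obtain ⟨B, hB⟩ := exists_hasLaplaceIntegralIci_mul_of_boundedVariationOn hg.comp_neg
    (hasLaplaceIntegralIic_iff.1 hB₀) h2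
  exact ⟨B + C, p, B, C, hasLaplaceIntegralIic_iff.2 hB, hC, rfl⟩

/-! ### The tent map and the gaps of the Cantor set. -/

/-- The tent map of slope three; its nonescaping set is the ternary Cantor set. -/
noncomputable def tentMap (x : ℝ) : ℝ := 3 * min x (1 - x)

lemma continuous_tentMap : Continuous tentMap := by unfold tentMap; fun_prop

lemma tentMap_of_le {x : ℝ} (h : x ≤ 1 / 2) : tentMap x = 3 * x := by
  rw [tentMap, min_eq_left (by linarith)]

lemma tentMap_of_ge {x : ℝ} (h : 1 / 2 ≤ x) : tentMap x = 3 * (1 - x) := by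
  rw [tentMap, min_eq_right (by linarith)]

lemma abs_tentMap_sub_le (x y : ℝ) : |tentMap x - tentMap y| ≤ 3 * |x - y| := by
  rcases abs_cases (x - y) with ⟨h, _⟩ | ⟨h, _⟩ <;>
  rcases le_total x (1 / 2) with hx | hx <;> rcases le_total y (1 / 2) with hy | hy <;>
  simp only [tentMap_of_le, tentMap_of_ge, hx, hy, h, abs_le] <;> constructor <;> linarith

lemma abs_iterate_tentMap_sub_le (j : ℕ) (x y : ℝ) :
    |tentMap^[j] x - tentMap^[j] y| ≤ 3 ^ j * |x - y| := by
  induction j with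
  | zero => simp
  | succ j ih =>
    rw [Function.iterate_succ_apply', Function.iterate_succ_apply']
    refine (abs_tentMap_sub_le _ _).trans ?_
    rw [pow_succ]
    linarith

lemma mem_Icc_of_tentMap_mem {x : ℝ} (h : tentMap x ∈ Icc (0 : ℝ) 1) :
    x ∈ Icc (0 : ℝ) 1 ∧ x ∉ Ioo (1 / 3 : ℝ) (2 / 3) := by
  rcases le_total x (1 / 2) with hx | hx
  · rw [tentMap_of_le hx] at h
    exact ⟨⟨by linarith [h.1], by linarith⟩, fun h' => by linarith [h.2, h'.1]⟩
  · rw [tentMap_of_ge hx] at h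
    exact ⟨⟨by linarith, by linarith [h.1]⟩, fun h' => by linarith [h.2, h'.2]⟩

lemma tentMap_mem_Icc {x : ℝ} (h : x ∈ Icc (0 : ℝ) 1) (h' : x ∉ Ioo (1 / 3 : ℝ) (2 / 3)) :
    tentMap x ∈ Icc (0 : ℝ) 1 := by
  rw [mem_Ioo, not_and_or, not_lt, not_lt] at h'
  rcases h' with h' | h'
  · rw [tentMap_of_le (by linarith)]
    exact ⟨by linarith [h.1], by linarith⟩
  · rw [tentMap_of_ge (by linarith)]
    exact ⟨by linarith [h.2], by linarith⟩

lemma mem_Icc_of_iterate_tentMap_mem (n : ℕ) : ∀ {x : ℝ}, tentMap^[n] x ∈ Icc (0 : ℝ) 1 →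
    x ∈ Icc (0 : ℝ) 1 := by
  induction n with
  | zero => exact fun h => h
  | succ n ih => exact fun h => (mem_Icc_of_tentMap_mem (ih h)).1

/-- The tent map sends the open middle third outside `[0, 1]`, and an orbit outside `[0, 1]` never
returns. -/
lemma iterate_tentMap_notMem_Ioo {i j : ℕ} (hij : i < j) {x : ℝ}
    (h : tentMap^[j] x ∈ Icc (0 : ℝ) 1) : tentMap^[i] x ∉ Ioo (1 / 3 : ℝ) (2 / 3) := by
  obtain ⟨k, rfl⟩ := Nat.exists_eq_add_of_lt hij
  have e : i + k + 1 = k + 1 + i := by ring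
  rw [e, Function.iterate_add_apply, Function.iterate_succ_apply] at h
  exact (mem_Icc_of_tentMap_mem (mem_Icc_of_iterate_tentMap_mem k h)).2

lemma Ioo_thirds_subset_Icc : Ioo (1 / 3 : ℝ) (2 / 3) ⊆ Icc 0 1 :=
  fun _ h => ⟨by linarith [h.1], by linarith [h.2]⟩

/-- The union of the gaps of generation `j` of the Cantor set. -/
def cantorGap (j : ℕ) : Set ℝ := {x | tentMap^[j] x ∈ Ioo (1 / 3 : ℝ) (2 / 3)}

lemma isOpen_cantorGap (j : ℕ) : IsOpen (cantorGap j) :=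
  isOpen_Ioo.preimage (continuous_tentMap.iterate j)

lemma cantorGap_unique {i j : ℕ} {x : ℝ} (hi : x ∈ cantorGap i) (hj : x ∈ cantorGap j) : i = j := by
  rcases lt_trichotomy i j with h | h | h
  · exact absurd hi (iterate_tentMap_notMem_Ioo h (Ioo_thirds_subset_Icc hj))
  · exact h
  · exact absurd hj (iterate_tentMap_notMem_Ioo h (Ioo_thirds_subset_Icc hi))

/-- The complement of all gaps: the Cantor set and the exterior of the unit interval. -/
def cantorComplement : Set ℝ := {x | ∀ j, x ∉ cantorGap j}

lemma isClosed_cantorComplement : IsClosed cantorComplement := by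
  have : cantorComplement = ⋂ j, (cantorGap j)ᶜ := by
    ext x; simp [cantorComplement]
  rw [this]
  exact isClosed_iInter fun j => (isOpen_cantorGap j).isClosed_compl

lemma mem_cantorComplement_of_notMem_Icc {x : ℝ} (hx : x ∉ Icc (0 : ℝ) 1) :
    x ∈ cantorComplement :=
  fun j hj => hx (mem_Icc_of_iterate_tentMap_mem j (Ioo_thirds_subset_Icc hj))

lemma tentMap_mem_cantorComplement {x : ℝ} (hx : x ∈ cantorComplement) :
    tentMap x ∈ cantorComplement := fun j hj => hx (j + 1) hj

/-- Near a preimage of `1 / 2` the iterated tent map is affine. -/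
lemma exists_iterate_tentMap_affine (j : ℕ) : ∀ {m : ℝ}, tentMap^[j] m = 1 / 2 →
    ∃ σ : ℝ, |σ| = 1 ∧ ∀ z, |z - m| < 1 / (2 * 3 ^ j) → tentMap^[j] z = 1 / 2 + σ * 3 ^ j * (z - m) := by
  induction j with
  | zero =>
    intro m hm
    refine ⟨1, abs_one, fun z _ => ?_⟩
    simp only [Function.iterate_zero, id] at hm ⊢
    rw [hm]; ring
  | succ j ih =>
    intro m hm
    obtain ⟨σ, hσ, h⟩ := ih (m := tentMap m) hm
    -- Since `m` avoids the middle third, it is at distance at least `1 / 6` from the fold at `1 /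
    -- 2`. The radius is at most `1 / 6`, so a single branch of the tent map is involved.
    have hmI : m ∉ Ioo (1 / 3 : ℝ) (2 / 3) :=
      iterate_tentMap_notMem_Ioo (i := 0) (j := j + 1) (Nat.succ_pos j)
        (by rw [hm]; constructor <;> norm_num)
    rw [mem_Ioo, not_and_or, not_lt, not_lt] at hmI
    have h3 : (1 : ℝ) ≤ 3 ^ j := one_le_pow₀ (by norm_num)
    have hr : (1 : ℝ) / (2 * 3 ^ (j + 1)) ≤ 1 / 6 := by
      rw [pow_succ]
      exact one_div_le_one_div_of_le (by norm_num) (by linarith)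
    have hr' : 3 * (1 / (2 * 3 ^ (j + 1))) = (1 : ℝ) / (2 * 3 ^ j) := by
      rw [pow_succ]; field_simp
    have key : ∀ τ : ℝ, |τ| = 1 → (∀ z, |z - m| < 1 / (2 * 3 ^ (j + 1)) →
        tentMap z - tentMap m = τ * 3 * (z - m)) → ∃ σ : ℝ, |σ| = 1 ∧
        ∀ z, |z - m| < 1 / (2 * 3 ^ (j + 1)) →
          tentMap^[j + 1] z = 1 / 2 + σ * 3 ^ (j + 1) * (z - m) := by
      intro τ hτ hz
      refine ⟨σ * τ, by rw [abs_mul, hσ, hτ, one_mul], fun z hzm => ?_⟩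
      rw [Function.iterate_succ_apply, h _ ?_, hz z hzm]
      · ring
      · rw [hz z hzm, abs_mul, abs_mul, hτ, one_mul, ← hr']
        norm_num
        simpa using hzm
    rcases hmI with hmI | hmI
    · refine key 1 abs_one fun z hz => ?_
      have hz' := (abs_lt.1 hz).2
      rw [tentMap_of_le (by linarith), tentMap_of_le (by linarith)]
      ring
    · refine key (-1) (by simp) fun z hz => ?_
      have hz' := (abs_lt.1 hz).1
      rw [tentMap_of_ge (by linarith), tentMap_of_ge (by linarith)]
      ring

/-- Every point of a gap is close to its midpoint. -/
lemma exists_midpoint_of_mem_cantorGap (j : ℕ) : ∀ {x : ℝ}, x ∈ cantorGap j →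
    ∃ m, tentMap^[j] m = 1 / 2 ∧ |x - m| < 1 / (6 * 3 ^ j) := by
  induction j with
  | zero =>
    intro x hx
    refine ⟨1 / 2, rfl, ?_⟩
    have h1 : (1 / 3 : ℝ) < x := hx.1
    have h2 : x < (2 / 3 : ℝ) := hx.2
    rw [abs_lt]
    constructor <;> norm_num <;> linarith
  | succ j ih =>
    intro x hx
    obtain ⟨m, hm, hxm⟩ := ih (x := tentMap x) hx
    have hm1 : m ∈ Icc (0 : ℝ) 1 :=
      mem_Icc_of_iterate_tentMap_mem j (by rw [hm]; constructor <;> norm_num)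
    have hr : (1 : ℝ) / (6 * 3 ^ (j + 1)) = (1 / (6 * 3 ^ j)) / 3 := by
      rw [pow_succ]; field_simp
    rcases le_total x (1 / 2) with h | h
    · rw [tentMap_of_le h] at hxm
      refine ⟨m / 3, ?_, ?_⟩
      · rw [Function.iterate_succ_apply, tentMap_of_le (by linarith [hm1.2]), ← hm]
        congr 1; ring
      · have : x - m / 3 = (3 * x - m) / 3 := by ring
        rw [hr, this, abs_div, abs_of_pos (by norm_num : (0 : ℝ) < 3)]
        linarith
    · rw [tentMap_of_ge h] at hxm
      refine ⟨1 - m / 3, ?_, ?_⟩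
      · rw [Function.iterate_succ_apply, tentMap_of_ge (by linarith [hm1.2]), ← hm]
        congr 1; ring
      · have : x - (1 - m / 3) = -((3 * (1 - x) - m) / 3) := by ring
        rw [hr, this, abs_neg, abs_div, abs_of_pos (by norm_num : (0 : ℝ) < 3)]
        linarith

/-! ### The example and its two successive primitives, built gap by gap. -/

open Classical in
/-- The function equal to `v j (T^j x)` on the gaps of generation `j` and to `0` elsewhere. -/
noncomputable def gapFunction (v : ℕ → ℝ → ℝ) (x : ℝ) : ℝ :=
  if h : ∃ j, x ∈ cantorGap j then v (Nat.find h) (tentMap^[Nat.find h] x) else 0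

lemma gapFunction_of_mem (v : ℕ → ℝ → ℝ) {j : ℕ} {x : ℝ} (hx : x ∈ cantorGap j) :
    gapFunction v x = v j (tentMap^[j] x) := by
  have h : ∃ j, x ∈ cantorGap j := ⟨j, hx⟩
  classical
  have e : Nat.find h = j := cantorGap_unique (Nat.find_spec h) hx
  rw [gapFunction, dif_pos h]
  convert rfl using 2 <;> first | exact e.symm | (congr 1; exact e.symm)

lemma gapFunction_of_mem_complement (v : ℕ → ℝ → ℝ) {x : ℝ} (hx : x ∈ cantorComplement) :
    gapFunction v x = 0 := by
  rw [gapFunction, dif_neg]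
  rintro ⟨j, hj⟩
  exact hx j hj

lemma eventually_gapFunction_eq (v : ℕ → ℝ → ℝ) {j : ℕ} {x : ℝ} (hx : x ∈ cantorGap j) :
    ∃ σ m : ℝ, |σ| = 1 ∧ (∀ᶠ z in 𝓝 x, tentMap^[j] z = 1 / 2 + σ * 3 ^ j * (z - m)) ∧
      ∀ᶠ z in 𝓝 x, gapFunction v z = v j (1 / 2 + σ * 3 ^ j * (z - m)) := by
  obtain ⟨m, hm, hxm⟩ := exists_midpoint_of_mem_cantorGap j hx
  obtain ⟨σ, hσ, h⟩ := exists_iterate_tentMap_affine j hm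
  have hlt : (1 : ℝ) / (6 * 3 ^ j) ≤ 1 / (2 * 3 ^ j) := by gcongr; norm_num
  have hev : ∀ᶠ z in 𝓝 x, |z - m| < 1 / (2 * 3 ^ j) :=
    (isOpen_lt (by fun_prop) continuous_const).mem_nhds (hxm.trans_le hlt)
  have hT : ∀ᶠ z in 𝓝 x, tentMap^[j] z = 1 / 2 + σ * 3 ^ j * (z - m) := hev.mono h
  refine ⟨σ, m, hσ, hT, ?_⟩
  filter_upwards [hT, (isOpen_cantorGap j).mem_nhds hx] with z hz hzg
  rw [gapFunction_of_mem v hzg, hz]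

/-- The oscillation placed in the gaps of generation `j`. -/
noncomputable def gapWave (j : ℕ) (y : ℝ) : ℝ :=
  (27 ^ j)⁻¹ * (((y - 1 / 3) * (2 / 3 - y)) ^ 3 * Real.sin (2 * Real.pi * 6 ^ j * (y - 1 / 2)))

lemma contDiff_gapWave (j : ℕ) : ContDiff ℝ 2 (gapWave j) := by
  unfold gapWave
  fun_prop

lemma hasDerivAt_gapWave (j : ℕ) (y : ℝ) : HasDerivAt (gapWave j) (deriv (gapWave j) y) y :=
  ((contDiff_gapWave j).differentiable (by norm_num) y).hasDerivAt

lemma hasDerivAt_deriv_gapWave (j : ℕ) (y : ℝ) :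
    HasDerivAt (deriv (gapWave j)) (deriv (deriv (gapWave j)) y) y := by
  have h : ContDiff ℝ 1 (deriv (gapWave j)) :=
    ((contDiff_succ_iff_deriv (n := 1)).1 (contDiff_gapWave j)).2.2
  exact (h.differentiable (by norm_num) y).hasDerivAt

lemma continuous_deriv_deriv_gapWave (j : ℕ) : Continuous (deriv (deriv (gapWave j))) := by
  have h : ContDiff ℝ 1 (deriv (gapWave j)) :=
    ((contDiff_succ_iff_deriv (n := 1)).1 (contDiff_gapWave j)).2.2
  exact h.continuous_deriv (by norm_num)

lemma deriv_gapWave (j : ℕ) (y : ℝ) : deriv (gapWave j) y = (27 ^ j)⁻¹ *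
    (3 * ((y - 1 / 3) * (2 / 3 - y)) ^ 2 * (1 - 2 * y) * Real.sin (2 * Real.pi * 6 ^ j * (y - 1 / 2))
    + ((y - 1 / 3) * (2 / 3 - y)) ^ 3 *
      (Real.cos (2 * Real.pi * 6 ^ j * (y - 1 / 2)) * (2 * Real.pi * 6 ^ j))) := by
  have h1 : HasDerivAt (fun y : ℝ => (y - 1 / 3) * (2 / 3 - y)) (1 - 2 * y) y := by
    refine (((hasDerivAt_id y).sub_const (1 / 3)).mul
      ((hasDerivAt_id y).const_sub (2 / 3))).congr_deriv ?_
    simp; ring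
  have h2 : HasDerivAt (fun y : ℝ => Real.sin (2 * Real.pi * 6 ^ j * (y - 1 / 2)))
      (Real.cos (2 * Real.pi * 6 ^ j * (y - 1 / 2)) * (2 * Real.pi * 6 ^ j * 1)) y :=
    (((hasDerivAt_id y).sub_const (1 / 2)).const_mul _).sin
  have h3 := ((h1.pow 3).mul h2).const_mul ((27 : ℝ) ^ j)⁻¹
  refine HasDerivAt.deriv (h3.congr_deriv ?_)
  simp

lemma gap_weight_mem {y : ℝ} (hy : y ∈ Ioo (1 / 3 : ℝ) (2 / 3)) :
    0 < (y - 1 / 3) * (2 / 3 - y) ∧ (y - 1 / 3) * (2 / 3 - y) ≤ 1 / 36 :=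
  ⟨mul_pos (by linarith [hy.1]) (by linarith [hy.2]), by nlinarith [sq_nonneg (y - 1 / 2)]⟩

/-- The weight is the product of the distances from `y` to the two ends of the middle third; both
are below `1`, and `|y - w|` is at least one of them. -/
lemma gap_weight_le_abs_sub {y w : ℝ} (hy : y ∈ Ioo (1 / 3 : ℝ) (2 / 3))
    (hw : w ∉ Ioo (1 / 3 : ℝ) (2 / 3)) : (y - 1 / 3) * (2 / 3 - y) ≤ |y - w| := by
  rw [mem_Ioo, not_and_or, not_lt, not_lt] at hw
  rcases hw with hw | hw
  · refine le_trans ?_ (le_abs_self _)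
    nlinarith [hy.1, hy.2]
  · refine le_trans ?_ (neg_le_abs _)
    nlinarith [hy.1, hy.2]

/-- The second primitive of the example. -/
noncomputable def cantorSecondPrimitive : ℝ → ℝ := gapFunction gapWave

/-- The primitive of the example. -/
noncomputable def cantorPrimitive : ℝ → ℝ := deriv cantorSecondPrimitive

/-- The Laplace integrable function which is not Henstock–Kurzweil integrable. -/
noncomputable def cantorExample : ℝ → ℝ :=
  gapFunction fun j y => 9 ^ j * deriv (deriv (gapWave j)) y

lemma gap_weight_le_of_mem {j : ℕ} {x p : ℝ} (hx : x ∈ cantorGap j) (hp : p ∈ cantorComplement) :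
    (tentMap^[j] x - 1 / 3) * (2 / 3 - tentMap^[j] x) ≤ 3 ^ j * |x - p| :=
  (gap_weight_le_abs_sub hx (hp j)).trans (abs_iterate_tentMap_sub_le j x p)

/-- On a gap of generation `j` the weight is at most `3 ^ j * |x - p|`; its cube costs `27 ^ j`,
exactly the amplitude built into `gapWave`. -/
lemma abs_cantorSecondPrimitive_le {x p : ℝ} (hp : p ∈ cantorComplement) :
    |cantorSecondPrimitive x| ≤ |x - p| ^ 3 := by
  unfold cantorSecondPrimitive
  by_cases hx : x ∈ cantorComplement
  · rw [gapFunction_of_mem_complement _ hx, abs_zero]; positivity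
  · simp only [cantorComplement, mem_ofPred_eq, not_forall, not_not] at hx
    obtain ⟨j, hx⟩ := hx
    rw [gapFunction_of_mem _ hx, gapWave, abs_mul, abs_mul, abs_inv, abs_pow, abs_pow]
    have h0 := gap_weight_mem hx
    have h1 := gap_weight_le_of_mem hx hp
    rw [abs_of_pos h0.1, abs_of_pos (by norm_num : (0 : ℝ) < 27),
      inv_mul_le_iff₀ (by positivity)]
    refine (mul_le_of_le_one_right (by have := h0.1; positivity) (Real.abs_sin_le_one _)).trans ?_
    refine (pow_le_pow_left₀ h0.1.le h1 3).trans_eq ?_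
    rw [mul_pow, ← pow_mul, mul_comm j 3, pow_mul]
    norm_num

lemma hasDerivAt_zero_of_abs_le_cube {H : ℝ → ℝ} {p : ℝ} (h : ∀ x, |H x| ≤ |x - p| ^ 3) :
    HasDerivAt H 0 p := by
  have h0 : H p = 0 := by simpa using h p
  rw [hasDerivAt_iff_isLittleO]
  simp only [h0, sub_zero, smul_zero]
  refine Asymptotics.IsBigO.trans_isLittleO (g := fun x => ‖x - p‖ ^ 3) ?_ ?_
  · exact Asymptotics.IsBigO.of_bound 1 (Eventually.of_forall fun x => by simpa using h x)
  · exact Asymptotics.isLittleO_pow_sub_sub p (m := 3) (by norm_num)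

lemma cantorPrimitive_of_mem_complement {p : ℝ} (hp : p ∈ cantorComplement) :
    cantorPrimitive p = 0 :=
  (hasDerivAt_zero_of_abs_le_cube fun _ => abs_cantorSecondPrimitive_le hp).deriv

lemma eventually_cantorPrimitive_eq {j : ℕ} {x : ℝ} (hx : x ∈ cantorGap j) :
    ∃ σ m : ℝ, |σ| = 1 ∧ (∀ᶠ z in 𝓝 x, tentMap^[j] z = 1 / 2 + σ * 3 ^ j * (z - m)) ∧
      (∀ᶠ z in 𝓝 x, HasDerivAt cantorSecondPrimitive
        (σ * 3 ^ j * deriv (gapWave j) (1 / 2 + σ * 3 ^ j * (z - m))) z) := by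
  obtain ⟨σ, m, hσ, h1, h2⟩ := eventually_gapFunction_eq gapWave hx
  refine ⟨σ, m, hσ, h1, ?_⟩
  filter_upwards [h2.eventually_nhds] with z hz
  have h3 : HasDerivAt (fun z => 1 / 2 + σ * 3 ^ j * (z - m)) (σ * 3 ^ j * 1) z :=
    (((hasDerivAt_id z).sub_const m).const_mul _).const_add _
  have h4 := HasDerivAt.comp z (hasDerivAt_gapWave j (1 / 2 + σ * 3 ^ j * (z - m))) h3
  exact (h4.congr_of_eventuallyEq hz).congr_deriv (by ring)

lemma hasDerivAt_cantorSecondPrimitive (x : ℝ) :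
    HasDerivAt cantorSecondPrimitive (cantorPrimitive x) x := by
  by_cases hx : x ∈ cantorComplement
  · rw [cantorPrimitive_of_mem_complement hx]
    exact hasDerivAt_zero_of_abs_le_cube fun _ => abs_cantorSecondPrimitive_le hx
  · simp only [cantorComplement, mem_ofPred_eq, not_forall, not_not] at hx
    obtain ⟨j, hx⟩ := hx
    obtain ⟨σ, m, hσ, h1, h2⟩ := eventually_cantorPrimitive_eq hx
    exact h2.self_of_nhds.differentiableAt.hasDerivAt

lemma hasDerivAt_cantorPrimitive {j : ℕ} {x : ℝ} (hx : x ∈ cantorGap j) :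
    HasDerivAt cantorPrimitive (cantorExample x) x := by
  obtain ⟨σ, m, hσ, h1, h2⟩ := eventually_cantorPrimitive_eq hx
  have h3 : HasDerivAt (fun z => 1 / 2 + σ * 3 ^ j * (z - m)) (σ * 3 ^ j * 1) x :=
    (((hasDerivAt_id x).sub_const m).const_mul _).const_add _
  have h4 := (HasDerivAt.comp x
    (hasDerivAt_deriv_gapWave j (1 / 2 + σ * 3 ^ j * (x - m))) h3).const_mul (σ * 3 ^ j)
  refine (h4.congr_of_eventuallyEq (h2.mono fun z hz => hz.deriv)).congr_deriv ?_
  rw [cantorExample, gapFunction_of_mem _ hx, h1.self_of_nhds]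
  have hs : σ * σ = 1 := by rw [← abs_mul_abs_self, hσ, one_mul]
  have h9 : (9 : ℝ) ^ j = 3 ^ j * 3 ^ j := by rw [← mul_pow]; norm_num
  rw [h9]
  linear_combination (3 ^ j * 3 ^ j * deriv (deriv (gapWave j)) (1 / 2 + σ * 3 ^ j * (x - m))) * hs

lemma abs_cantorPrimitive_eq {j : ℕ} {x : ℝ} (hx : x ∈ cantorGap j) :
    |cantorPrimitive x| = 3 ^ j * |deriv (gapWave j) (tentMap^[j] x)| := by
  obtain ⟨σ, m, hσ, h1, h2⟩ := eventually_cantorPrimitive_eq hx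
  rw [cantorPrimitive, h2.self_of_nhds.deriv, h1.self_of_nhds, abs_mul, abs_mul, hσ, one_mul,
    abs_of_pos (by positivity : (0 : ℝ) < 3 ^ j)]

/-- The chain rule contributes `3 ^ j`, the amplitude `(27 ^ j)⁻¹` and the frequency `6 ^ j`;
together they give `(2 / 3) ^ j`. -/
lemma three_pow_mul_abs_deriv_gapWave_le {j : ℕ} {y : ℝ} (hy : y ∈ Ioo (1 / 3 : ℝ) (2 / 3)) :
    3 ^ j * |deriv (gapWave j) y| ≤ (2 / 3) ^ j * ((y - 1 / 3) * (2 / 3 - y)) := by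
  obtain ⟨h0, h1⟩ := gap_weight_mem hy
  rw [deriv_gapWave]
  set q := (y - 1 / 3) * (2 / 3 - y)
  set s := Real.sin (2 * Real.pi * 6 ^ j * (y - 1 / 2))
  set c := Real.cos (2 * Real.pi * 6 ^ j * (y - 1 / 2))
  have hs : |s| ≤ 1 := Real.abs_sin_le_one _
  have hc : |c| ≤ 1 := Real.abs_cos_le_one _
  have h6 : (1 : ℝ) ≤ 6 ^ j := one_le_pow₀ (by norm_num)
  have hy1 : |1 - 2 * y| ≤ 1 := by rw [abs_le]; constructor <;> linarith [hy.1, hy.2]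
  have hpi := Real.pi_lt_four
  have e : (2 / 3 : ℝ) ^ j = 3 ^ j * (27 ^ j)⁻¹ * 6 ^ j := by
    rw [← inv_pow, ← mul_pow, ← mul_pow]; norm_num
  rw [abs_mul, abs_inv, abs_pow, abs_of_pos (by norm_num : (0 : ℝ) < 27), e, ← mul_assoc,
    mul_assoc ((3 : ℝ) ^ j * (27 ^ j)⁻¹) (6 ^ j)]
  refine mul_le_mul_of_nonneg_left ((abs_add_le _ _).trans ?_) (by positivity)
  have t1 : |3 * q ^ 2 * (1 - 2 * y) * s| ≤ 3 * q ^ 2 := by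
    rw [abs_mul, abs_mul, abs_of_nonneg (by positivity : 0 ≤ 3 * q ^ 2), mul_assoc]
    exact mul_le_of_le_one_right (by positivity) (mul_le_one₀ hy1 (abs_nonneg s) hs)
  have t2 : |q ^ 3 * (c * (2 * Real.pi * 6 ^ j))| ≤ q ^ 3 * (8 * 6 ^ j) := by
    rw [abs_mul, abs_mul, abs_of_nonneg (by positivity : 0 ≤ q ^ 3),
      abs_of_pos (by positivity : 0 < 2 * Real.pi * 6 ^ j)]
    refine mul_le_mul_of_nonneg_left ?_ (by positivity)
    calc |c| * (2 * Real.pi * 6 ^ j) ≤ 1 * (2 * Real.pi * 6 ^ j) := by gcongr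
      _ ≤ 8 * 6 ^ j := by rw [one_mul]; gcongr; linarith
  have t3 : 3 * q ^ 2 ≤ 1 / 12 * q * 6 ^ j := by nlinarith [mul_pos h0 (by linarith : (0:ℝ) < 6 ^ j)]
  have t4 : q ^ 3 * (8 * 6 ^ j) ≤ 1 / 2 * q * 6 ^ j := by
    have : q ^ 2 ≤ 1 / 16 := by nlinarith
    have h7 : 0 ≤ q * 6 ^ j := by positivity
    calc q ^ 3 * (8 * 6 ^ j) = q ^ 2 * (8 * (q * 6 ^ j)) := by ring
      _ ≤ 1 / 16 * (8 * (q * 6 ^ j)) := by gcongr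
      _ = _ := by ring
  have h7 : 0 ≤ q * 6 ^ j := by positivity
  linarith

/-- A Hölder estimate for the primitive near the Cantor set. -/
lemma abs_cantorPrimitive_cube_le {x p : ℝ} (hp : p ∈ cantorComplement) :
    |cantorPrimitive x| ^ 3 ≤ |x - p| := by
  by_cases hx : x ∈ cantorComplement
  · rw [cantorPrimitive_of_mem_complement hx]; simp
  · simp only [cantorComplement, mem_ofPred_eq, not_forall, not_not] at hx
    obtain ⟨j, hx⟩ := hx
    rw [abs_cantorPrimitive_eq hx]
    have h1 := three_pow_mul_abs_deriv_gapWave_le (j := j) hx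
    obtain ⟨h2, h3⟩ := gap_weight_mem hx
    have h4 := gap_weight_le_of_mem hx hp
    set q := (tentMap^[j] x - 1 / 3) * (2 / 3 - tentMap^[j] x)
    -- The weight costs `3 ^ j`, and `(2 / 3) ^ (3 * j) * 3 ^ j = (8 / 9) ^ j`. A square in place of
    -- the cube would leave `(4 / 3) ^ j`.
    have h89 : (8 / 9 : ℝ) ^ j ≤ 1 := pow_le_one₀ (by norm_num) (by norm_num)
    calc (3 ^ j * |deriv (gapWave j) (tentMap^[j] x)|) ^ 3 ≤ ((2 / 3) ^ j * q) ^ 3 := by gcongr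
      _ = ((2 / 3) ^ j) ^ 3 * (q * q) * q := by ring
      _ ≤ ((2 / 3) ^ j) ^ 3 * 1 * (3 ^ j * |x - p|) := by
        gcongr
        nlinarith
      _ = (8 / 9) ^ j * |x - p| := by
        rw [← pow_mul, mul_comm j 3, pow_mul, mul_one, ← mul_assoc, ← mul_pow]; norm_num
      _ ≤ 1 * |x - p| := by gcongr
      _ = _ := one_mul _

lemma continuous_cantorPrimitive : Continuous cantorPrimitive := by
  refine continuous_iff_continuousAt.2 fun x => ?_
  by_cases hx : x ∈ cantorComplement
  · rw [ContinuousAt, cantorPrimitive_of_mem_complement hx, tendsto_zero_iff_abs_tendsto_zero]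
    have h1 : Tendsto (fun z => |z - x|) (𝓝 x) (𝓝 0) := by
      have : Continuous fun z => |z - x| := by fun_prop
      simpa using this.tendsto x
    rw [Metric.tendsto_nhds] at h1 ⊢
    intro ε hε
    filter_upwards [h1 (ε ^ 3) (by positivity)] with z hz
    simp only [dist_zero_right, Function.comp, Real.norm_eq_abs, abs_abs] at hz ⊢
    exact lt_of_pow_lt_pow_left₀ 3 hε.le ((abs_cantorPrimitive_cube_le hx).trans_lt hz)
  · simp only [cantorComplement, mem_ofPred_eq, not_forall, not_not] at hx
    obtain ⟨j, hx⟩ := hx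
    exact (hasDerivAt_cantorPrimitive hx).continuousAt

/-! ### Laplace integrability of the example. -/

lemma integral_exp_neg_mul_mul_cube_le {s : ℝ} (hs : 0 < s) :
    ∫ t in (0 : ℝ)..1, Real.exp (-s * t) * t ^ 3 ≤ 6 / s ^ 4 := by
  have hd : ∀ t : ℝ, HasDerivAt
      (fun t => -((t ^ 3 / s + 3 * t ^ 2 / s ^ 2 + 6 * t / s ^ 3 + 6 / s ^ 4) * Real.exp (-s * t)))
      (Real.exp (-s * t) * t ^ 3) t := by
    intro t
    have h1 : HasDerivAt (fun t : ℝ => t ^ 3 / s + 3 * t ^ 2 / s ^ 2 + 6 * t / s ^ 3 + 6 / s ^ 4)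
        (3 * t ^ 2 / s + 3 * (2 * t) / s ^ 2 + 6 / s ^ 3) t := by
      refine (((((hasDerivAt_pow 3 t).div_const s).add
        (((hasDerivAt_pow 2 t).const_mul 3).div_const (s ^ 2))).add
        (((hasDerivAt_id t).const_mul 6).div_const (s ^ 3))).add_const (6 / s ^ 4)).congr_deriv ?_
      simp
    have h2 : HasDerivAt (fun t : ℝ => Real.exp (-s * t)) (Real.exp (-s * t) * (-s * 1)) t :=
      ((hasDerivAt_id t).const_mul (-s)).exp
    refine (h1.mul h2).neg.congr_deriv ?_
    field_simp
    ring
  rw [intervalIntegral.integral_eq_sub_of_hasDerivAt (fun t _ => hd t)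
    (Continuous.intervalIntegrable (by fun_prop) _ _)]
  have h3 : 0 ≤ (1 ^ 3 / s + 3 * 1 ^ 2 / s ^ 2 + 6 * 1 / s ^ 3 + 6 / s ^ 4) * Real.exp (-s * 1) := by
    positivity
  simp only [mul_zero, Real.exp_zero]
  norm_num at h3 ⊢
  linarith

/-- If a primitive of `F` vanishes to third order at `x`, the Laplace derivate of `F` vanishes. -/
lemma lowerLaplaceRightGE_zero_of_primitive {F H : ℝ → ℝ} (hF : Continuous F)
    (hH : ∀ z, HasDerivAt H (F z) z) {x : ℝ} (hx : F x = 0) (h : ∀ z, |H z| ≤ |z - x| ^ 3) :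
    LowerLaplaceRightGE F x 0 := by
  have h0 : H x = 0 := by simpa using h x
  have hHc : Continuous H := continuous_iff_continuousAt.2 fun z => (hH z).continuousAt
  have hlim : Tendsto (fun s : ℝ => s ^ 2 * Real.exp (-s * 1) * H (x + 1) - 6 / s) atTop
      (𝓝 (0 * H (x + 1) - 0)) :=
    ((tendsto_sq_mul_exp_neg_mul one_pos 2).mul_const _).sub (tendsto_id.const_div_atTop 6)
  simp only [zero_mul, sub_zero] at hlim
  intro c' hc'
  filter_upwards [hlim.eventually_const_lt hc', eventually_gt_atTop 0] with s hs hs0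
  refine hs.trans_le ?_
  -- Integration by parts replaces `F` by `H` at the price of one more factor `s`. The boundary term
  -- decays exponentially, and `|H| ≤ t ^ 3` leaves an error of at most `s ^ 3 * (6 / s ^ 4)`.
  have hparts : ∫ t in (0 : ℝ)..1, Real.exp (-s * t) * F (x + t) =
      Real.exp (-s * 1) * H (x + 1) - Real.exp (-s * 0) * H (x + 0) -
        ∫ t in (0 : ℝ)..1, (Real.exp (-s * t) * (-s * 1)) * H (x + t) := by
    refine intervalIntegral.integral_mul_deriv_eq_deriv_mul
      (fun t _ => ((hasDerivAt_id t).const_mul (-s)).exp) (fun t _ => (hH (x + t)).comp_const_add x t)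
      (Continuous.intervalIntegrable (by fun_prop) _ _)
      (Continuous.intervalIntegrable (by fun_prop) _ _)
  have e : laplaceQuotRight F x 1 s = s ^ 2 * Real.exp (-s * 1) * H (x + 1) +
      s ^ 3 * ∫ t in (0 : ℝ)..1, Real.exp (-s * t) * H (x + t) := by
    unfold laplaceQuotRight
    simp only [hx, sub_zero]
    rw [hparts, add_zero, h0]
    have : ∀ t, (Real.exp (-s * t) * (-s * 1)) * H (x + t) =
      -s * (Real.exp (-s * t) * H (x + t)) := fun t => by ring
    simp only [this]
    rw [intervalIntegral.integral_const_mul]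
    ring
  have hb : -(∫ t in (0 : ℝ)..1, Real.exp (-s * t) * t ^ 3) ≤
      ∫ t in (0 : ℝ)..1, Real.exp (-s * t) * H (x + t) := by
    rw [← intervalIntegral.integral_neg]
    refine intervalIntegral.integral_mono_on zero_le_one
      (Continuous.intervalIntegrable (by fun_prop) _ _)
      (Continuous.intervalIntegrable (by fun_prop) _ _) fun t ht => ?_
    have h1 := h (x + t)
    rw [add_sub_cancel_left, abs_of_nonneg ht.1] at h1
    rw [← mul_neg]
    exact mul_le_mul_of_nonneg_left (abs_le.1 h1).1 (Real.exp_pos _).le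
  have h6 := integral_exp_neg_mul_mul_cube_le hs0
  have h7 : s ^ 3 * -(6 / s ^ 4) ≤ s ^ 3 * ∫ t in (0 : ℝ)..1, Real.exp (-s * t) * H (x + t) :=
    mul_le_mul_of_nonneg_left (by linarith) (by positivity)
  have h8 : s ^ 3 * -(6 / s ^ 4) = -(6 / s) := by field_simp
  rw [e]
  linarith

/-- In a gap the primitive is differentiable; elsewhere the second primitive vanishes to third
order, so the Laplace derivates are `0`. Having one function in both roles makes the Cauchy
criterion trivial. -/
lemma isLaplaceMajor_cantorExample (a b : ℝ) :
    IsLaplaceMajor cantorExample a b cantorPrimitive ∧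
      IsLaplaceMinor cantorExample a b cantorPrimitive := by
  have hn : ∀ {x}, x ∉ cantorComplement → ∃ j, x ∈ cantorGap j := fun {x} hx => by
    simpa [cantorComplement] using hx
  have hFc := continuous_cantorPrimitive
  have hFn : Continuous fun z => -cantorPrimitive z := hFc.neg
  have hH := hasDerivAt_cantorSecondPrimitive
  have hr : ∀ {G F : ℝ → ℝ} {z : ℝ}, (∀ w, HasDerivAt G (F w) w) →
      HasDerivAt (fun z => G (-z)) (negReflect F z) z := fun {G F z} hGF => by
    simpa [Function.comp_def, negReflect] using HasDerivAt.comp z (hGF (-z)) (hasDerivAt_neg z)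
  have hr' : ∀ {F : ℝ → ℝ} {x c : ℝ}, HasDerivAt F c x → HasDerivAt (negReflect F) c (-x) :=
    fun {F x c} hF => by
      have h1 : HasDerivAt F c (- -x) := by rwa [neg_neg]
      have h2 := (HasDerivAt.comp (-x) h1 (hasDerivAt_neg (-x))).neg
      rwa [mul_neg, mul_one, neg_neg] at h2
  have hb : ∀ {x}, x ∈ cantorComplement → ∀ z, |cantorSecondPrimitive (-z)| ≤ |z - -x| ^ 3 :=
    fun {x} hx z => by
      have h1 := abs_cantorSecondPrimitive_le (x := -z) hx
      rwa [show -z - x = -(z - -x) by ring, abs_neg] at h1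
  refine ⟨(isLaplaceMajor_iff_of_continuous hFc).2 ⟨fun x _ => ?_, fun x _ => ?_⟩,
    isLaplaceMinor_iff.2 ((isLaplaceMajor_iff_of_continuous hFn).2
      ⟨fun x _ => ?_, fun x _ => ?_⟩)⟩ <;> by_cases hx : x ∈ cantorComplement
  · rw [cantorExample, gapFunction_of_mem_complement _ hx]
    exact lowerLaplaceRightGE_zero_of_primitive hFc hH (cantorPrimitive_of_mem_complement hx)
      fun z => abs_cantorSecondPrimitive_le hx
  · obtain ⟨j, hj⟩ := hn hx
    exact lowerLaplaceRightGE_of_hasDerivWithinAt hFc (hasDerivAt_cantorPrimitive hj).hasDerivWithinAt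
  · rw [cantorExample, gapFunction_of_mem_complement _ hx]
    exact lowerLaplaceRightGE_zero_of_primitive hFc.negReflect (fun z => hr hH)
      (by simp [negReflect, cantorPrimitive_of_mem_complement hx]) (hb hx)
  · obtain ⟨j, hj⟩ := hn hx
    exact lowerLaplaceRightGE_of_hasDerivWithinAt hFc.negReflect
      (hr' (hasDerivAt_cantorPrimitive hj)).hasDerivWithinAt
  · rw [cantorExample, gapFunction_of_mem_complement _ hx, neg_zero]
    exact lowerLaplaceRightGE_zero_of_primitive hFn (fun z => (hH z).neg)
      (by simp [cantorPrimitive_of_mem_complement hx])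
      fun z => by simpa using abs_cantorSecondPrimitive_le (x := z) hx
  · obtain ⟨j, hj⟩ := hn hx
    exact lowerLaplaceRightGE_of_hasDerivWithinAt hFn
      (hasDerivAt_cantorPrimitive hj).neg.hasDerivWithinAt
  · rw [cantorExample, gapFunction_of_mem_complement _ hx, neg_zero]
    exact lowerLaplaceRightGE_zero_of_primitive hFn.negReflect
      (fun z => hr fun w => (hH w).neg)
      (by simp [negReflect, cantorPrimitive_of_mem_complement hx])
      fun z => by simpa using hb hx z
  · obtain ⟨j, hj⟩ := hn hx
    exact lowerLaplaceRightGE_of_hasDerivWithinAt hFn.negReflect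
      (hr' (hasDerivAt_cantorPrimitive hj).neg).hasDerivWithinAt

lemma locallyLaplaceIntegrable_cantorExample : LocallyLaplaceIntegrable cantorExample := by
  intro a b hab
  obtain ⟨h1, h2⟩ := isLaplaceMajor_cantorExample a b
  exact laplaceIntegrableOn_iff.2 ⟨hab, fun ε hε => ⟨_, _, continuous_cantorPrimitive,
    continuous_cantorPrimitive, h1, h2, by simpa using hε⟩⟩

lemma cantorExample_of_notMem_Icc {x : ℝ} (hx : x ∉ Icc (0 : ℝ) 1) : cantorExample x = 0 :=
  gapFunction_of_mem_complement _ (mem_cantorComplement_of_notMem_Icc hx)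

lemma lebesgueIntegrableNearInfty_cantorExample : LebesgueIntegrableNearInfty cantorExample := by
  refine ⟨2, (integrableOn_zero (μ := volume)).congr_fun (fun x hx => ?_) measurableSet_Ioo.compl⟩
  refine (cantorExample_of_notMem_Icc fun h => hx ⟨?_, ?_⟩).symm <;> linarith [h.1, h.2]

/-- On each gap the primitive oscillates by a multiple of `(2 / 3) ^ j`. -/
lemma exists_cantorPrimitive_oscillation {j : ℕ} {m : ℝ} (hm : tentMap^[j] m = 1 / 2) :
    ∃ z, |z - m| < 1 / (6 * 3 ^ j) ∧
      1 / 10000 * (2 / 3) ^ j ≤ |cantorPrimitive z - cantorPrimitive m| := by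
  obtain ⟨σ, hσ, h⟩ := exists_iterate_tentMap_affine j hm
  have hσ0 : σ ≠ 0 := by rintro rfl; simp at hσ
  -- Rolle's theorem: the weight vanishes at `1 / 3` and the sine at `1 / 2`. The primitive is
  -- therefore `0` at the point corresponding to `y`.
  obtain ⟨y, hy, hy0⟩ := exists_deriv_eq_zero (f := gapWave j) (by norm_num : (1 / 3 : ℝ) < 1 / 2)
    (contDiff_gapWave j).continuous.continuousOn (by simp [gapWave])
  have h3 : (0 : ℝ) < 3 ^ j := by positivity
  refine ⟨m + (y - 1 / 2) / (σ * 3 ^ j), ?_, ?_⟩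
  · rw [add_sub_cancel_left, abs_div, abs_mul, hσ, one_mul, abs_of_pos h3, ← div_div]
    gcongr
    rw [abs_lt]
    constructor <;> linarith [hy.1, hy.2]
  · have e1 : tentMap^[j] (m + (y - 1 / 2) / (σ * 3 ^ j)) = y := by
      rw [h, add_sub_cancel_left]
      · field_simp; ring
      · rw [add_sub_cancel_left, abs_div, abs_mul, hσ, one_mul, abs_of_pos h3, ← div_div]
        gcongr
        rw [abs_lt]
        constructor <;> linarith [hy.1, hy.2]
    have g1 : m + (y - 1 / 2) / (σ * 3 ^ j) ∈ cantorGap j := by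
      rw [cantorGap, mem_ofPred_eq, e1]
      exact ⟨hy.1, by linarith [hy.2]⟩
    have g2 : m ∈ cantorGap j := by
      rw [cantorGap, mem_ofPred_eq, hm]
      constructor <;> norm_num
    have z1 : cantorPrimitive (m + (y - 1 / 2) / (σ * 3 ^ j)) = 0 := by
      rw [← abs_eq_zero, abs_cantorPrimitive_eq g1, e1, hy0]; simp
    -- At the midpoint the weight is `1 / 36` and the cosine is `1`, so the value is `2 * π / 36 ^ 3
    -- * (2 / 3) ^ j`; `π > 3` yields the constant `1 / 10000`.
    rw [z1, zero_sub, abs_neg, abs_cantorPrimitive_eq g2, hm, deriv_gapWave]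
    have e : (2 / 3 : ℝ) ^ j = 3 ^ j * (27 ^ j)⁻¹ * 6 ^ j := by
      rw [← inv_pow, ← mul_pow, ← mul_pow]; norm_num
    norm_num
    rw [abs_of_pos Real.pi_pos, e]
    have := Real.pi_gt_three
    have h5 : (0 : ℝ) < 3 ^ j * (27 ^ j)⁻¹ * 6 ^ j := by positivity
    nlinarith

/-! ### One-dimensional Henstock–Kurzweil integration through boxes. -/

/-- The interval `(c, d]` as a one-dimensional box (a default box when `d ≤ c`). -/
noncomputable def lineBox (c d : ℝ) : BoxIntegral.Box (Fin 1) :=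
  if h : c < d then ⟨fun _ => c, fun _ => d, fun _ => h⟩ else ⟨fun _ => 0, fun _ => 1, fun _ => one_pos⟩

lemma lineBox_of_lt {c d : ℝ} (h : c < d) :
    lineBox c d = ⟨fun _ => c, fun _ => d, fun _ => h⟩ := dif_pos h

lemma lower_lineBox {c d : ℝ} (h : c < d) : (lineBox c d).lower = fun _ => c := by
  rw [lineBox_of_lt h]

lemma upper_lineBox {c d : ℝ} (h : c < d) : (lineBox c d).upper = fun _ => d := by
  rw [lineBox_of_lt h]

lemma mem_lineBox {c d : ℝ} (h : c < d) {x : Fin 1 → ℝ} : x ∈ lineBox c d ↔ x 0 ∈ Ioc c d := by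
  rw [lineBox_of_lt h]
  simp [BoxIntegral.Box.mem_def]

lemma lineBox_le {a b c d : ℝ} (hac : a ≤ c) (hcd : c < d) (hdb : d ≤ b) :
    lineBox c d ≤ lineBox a b := by
  intro x hx
  rw [mem_lineBox hcd] at hx
  exact (mem_lineBox (by linarith)).2 ⟨hac.trans_lt hx.1, hx.2.trans hdb⟩

lemma mem_Icc_lineBox {c d : ℝ} (h : c < d) {x : Fin 1 → ℝ} :
    x ∈ BoxIntegral.Box.Icc (lineBox c d) ↔ x 0 ∈ Icc c d := by
  rw [BoxIntegral.Box.Icc_def, lower_lineBox h, upper_lineBox h]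
  simp [Pi.le_def]

/-- The Henstock–Kurzweil integral over `(c, d]`. -/
noncomputable def hkIntegral (f : ℝ → ℝ) (c d : ℝ) : ℝ :=
  BoxIntegral.integral (lineBox c d) BoxIntegral.IntegrationParams.Henstock (fun x => f (x 0))
    (BoxIntegral.BoxAdditiveMap.volume : BoxIntegral.BoxAdditiveMap (Fin 1) (ℝ →L[ℝ] ℝ) ⊤)

lemma hkIntegral_eq_of_continuousOn {f : ℝ → ℝ} {c d : ℝ} (h : c < d)
    (hf : ContinuousOn f (Icc c d)) : hkIntegral f c d = ∫ x in c..d, f x := by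
  have hc : ContinuousOn (fun x : Fin 1 → ℝ => f (x 0)) (BoxIntegral.Box.Icc (lineBox c d)) :=
    hf.comp (continuous_apply 0).continuousOn fun x hx => (mem_Icc_lineBox h).1 hx
  have h1 := (hc.hasBoxIntegral volume BoxIntegral.IntegrationParams.Henstock).integral_eq
  have h2 := (volume_preserving_funUnique (Fin 1) ℝ).setIntegral_preimage_emb
    (MeasurableEquiv.measurableEmbedding _) f (Ioc c d)
  rw [hkIntegral, intervalIntegral.integral_of_le h.le, ← h2]
  refine h1.trans ?_
  have : (lineBox c d : Set (Fin 1 → ℝ)) =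
      (MeasurableEquiv.funUnique (Fin 1) ℝ) ⁻¹' Ioc c d := by
    ext x
    exact mem_lineBox h
  rw [this]
  rfl

lemma HKIntegrableOn.hkIntegral_add {f : ℝ → ℝ} {a b : ℝ} {hab : a < b}
    (hf : HKIntegrableOn f a b hab) {c d e : ℝ} (hac : a ≤ c) (hcd : c < d) (hde : d < e)
    (heb : e ≤ b) : hkIntegral f c d + hkIntegral f d e = hkIntegral f c e := by
  unfold HKIntegrableOn at hf
  rw [← lineBox_of_lt hab] at hf
  have hce := hcd.trans hde
  have h1 := hf.toBoxAdditive.map_split_add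
    (WithTop.coe_le_coe.2 (lineBox_le hac hce heb)) 0 d
  have hd : d ∈ Ioo ((lineBox c e).lower 0) ((lineBox c e).upper 0) := by
    rw [lower_lineBox hce, upper_lineBox hce]; exact ⟨hcd, hde⟩
  rw [BoxIntegral.Box.splitLower_def hd, BoxIntegral.Box.splitUpper_def hd] at h1
  have e1 : ∀ h, (⟨(lineBox c e).lower, Function.update (lineBox c e).upper 0 d, h⟩ :
      BoxIntegral.Box (Fin 1)) = lineBox c d := by
    intro h
    rw [lineBox_of_lt hcd]
    congr 1
    · exact lower_lineBox hce
    · funext i; rw [Subsingleton.elim i 0]; simp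
  have e2 : ∀ h, (⟨Function.update (lineBox c e).lower 0 d, (lineBox c e).upper, h⟩ :
      BoxIntegral.Box (Fin 1)) = lineBox d e := by
    intro h
    rw [lineBox_of_lt hde]
    congr 1
    · funext i; rw [Subsingleton.elim i 0]; simp
    · exact upper_lineBox hce
  rw [e1, e2] at h1
  exact h1

/-- The Henstock–Sacks lemma on the line, for families of intervals tagged at the left end. -/
lemma HKIntegrableOn.exists_gauge {f : ℝ → ℝ} {a b : ℝ} {hab : a < b}
    (hf : HKIntegrableOn f a b hab) {ε : ℝ} (hε : 0 < ε) :
    ∃ r : ℝ → ℝ, (∀ x, 0 < r x) ∧ ∀ (S : Finset ℝ) (l u : ℝ → ℝ),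
      (∀ i ∈ S, a ≤ l i ∧ l i < u i ∧ u i ≤ b ∧ u i - l i ≤ r (l i)) →
      (S : Set ℝ).Pairwise (fun i k => Disjoint (Ioc (l i) (u i)) (Ioc (l k) (u k))) →
      |∑ i ∈ S, (f (l i) * (u i - l i) - hkIntegral f (l i) (u i))| ≤ ε := by
  classical
  unfold HKIntegrableOn at hf
  rw [← lineBox_of_lt hab] at hf
  refine ⟨fun x => hf.convergenceR ε 0 fun _ => x, fun x => (hf.convergenceR ε 0 _).2, ?_⟩
  intro S l u hS hdisj
  have hdisj' : ∀ i ∈ S, ∀ k ∈ S, i ≠ k →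
      Disjoint (lineBox (l i) (u i) : Set (Fin 1 → ℝ)) (lineBox (l k) (u k)) := by
    intro i hi k hk hik
    rw [Set.disjoint_left]
    intro x hx hx'
    exact Set.disjoint_left.1 (hdisj hi hk hik) ((mem_lineBox (hS i hi).2.1).1 hx)
      ((mem_lineBox (hS k hk).2.1).1 hx')
  have hinj : Set.InjOn (fun i => lineBox (l i) (u i)) S := by
    intro i hi k hk hik
    by_contra hne
    have h1 := hdisj' i hi k hk hne
    simp only at hik
    rw [hik, disjoint_self] at h1
    exact (lineBox (l k) (u k)).nonempty_coe.ne_empty h1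
  let π : BoxIntegral.TaggedPrepartition (lineBox a b) :=
    { boxes := S.image fun i => lineBox (l i) (u i)
      le_of_mem' := by
        intro J hJ
        obtain ⟨i, hi, rfl⟩ := Finset.mem_image.1 hJ
        exact lineBox_le (hS i hi).1 (hS i hi).2.1 (hS i hi).2.2.1
      pairwiseDisjoint := by
        intro J hJ J' hJ' hne
        obtain ⟨i, hi, rfl⟩ := Finset.mem_image.1 hJ
        obtain ⟨k, hk, rfl⟩ := Finset.mem_image.1 hJ'
        exact hdisj' i hi k hk fun h => hne (by rw [h])
      -- The tag must lie in the closed box for every `J`, including boxes not in the family; these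
      -- may get a dummy corner.
      tag := fun J => if J.lower ∈ BoxIntegral.Box.Icc (lineBox a b) then J.lower
        else (lineBox a b).lower
      tag_mem_Icc := by
        intro J
        split_ifs with h
        · exact h
        · exact BoxIntegral.Box.lower_mem_Icc _ }
  have htag : ∀ i ∈ S, π.tag (lineBox (l i) (u i)) = fun _ => l i := by
    intro i hi
    obtain ⟨h1, h2, h3, -⟩ := hS i hi
    have : (lineBox (l i) (u i)).lower ∈ BoxIntegral.Box.Icc (lineBox a b) := by
      rw [mem_Icc_lineBox hab, lower_lineBox h2]
      exact ⟨h1, by linarith⟩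
    simp only [π, if_pos this]
    exact lower_lineBox h2
  have hbase : BoxIntegral.IntegrationParams.Henstock.MemBaseSet (lineBox a b) 0
      (hf.convergenceR ε 0) π := by
    refine ⟨?_, fun _ => ?_, fun h => ?_, fun h => ?_⟩
    · intro J hJ
      obtain ⟨i, hi, rfl⟩ := Finset.mem_image.1 hJ
      obtain ⟨h1, h2, h3, h4⟩ := hS i hi
      rw [htag i hi]
      intro x hx
      rw [mem_Icc_lineBox h2] at hx
      rw [Metric.mem_closedBall, dist_pi_le_iff (hf.convergenceR ε 0 _).2.le]
      intro k
      rw [Subsingleton.elim k 0, Real.dist_eq, abs_of_nonneg (by linarith [hx.1])]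
      linarith [hx.2]
    · intro J hJ
      obtain ⟨i, hi, rfl⟩ := Finset.mem_image.1 hJ
      obtain ⟨h1, h2, -⟩ := hS i hi
      rw [htag i hi, mem_Icc_lineBox h2]
      exact ⟨le_rfl, h2.le⟩
    · exact absurd h (by decide)
    · exact absurd h (by decide)
  -- This inequality does not require the tagged intervals to cover `[a, b]`.
  have h := hf.dist_integralSum_sum_integral_le_of_memBaseSet hε hbase
  have e1 : BoxIntegral.integralSum (fun x : Fin 1 → ℝ => f (x 0))
      (BoxIntegral.BoxAdditiveMap.volume : BoxIntegral.BoxAdditiveMap (Fin 1) (ℝ →L[ℝ] ℝ) ⊤) π =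
      ∑ i ∈ S, f (l i) * (u i - l i) := by
    unfold BoxIntegral.integralSum
    rw [show π.boxes = S.image fun i => lineBox (l i) (u i) from rfl, Finset.sum_image hinj]
    refine Finset.sum_congr rfl fun i hi => ?_
    rw [htag i hi, BoxIntegral.BoxAdditiveMap.volume_apply, lower_lineBox (hS i hi).2.1,
      upper_lineBox (hS i hi).2.1]
    simp [mul_comm]
  have e2 : ∑ J ∈ π.boxes, BoxIntegral.integral J BoxIntegral.IntegrationParams.Henstock
      (fun x : Fin 1 → ℝ => f (x 0))
      (BoxIntegral.BoxAdditiveMap.volume : BoxIntegral.BoxAdditiveMap (Fin 1) (ℝ →L[ℝ] ℝ) ⊤) =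
      ∑ i ∈ S, hkIntegral f (l i) (u i) := by
    rw [show π.boxes = S.image fun i => lineBox (l i) (u i) from rfl, Finset.sum_image hinj]
    rfl
  rw [e1, e2, Real.dist_eq, ← Finset.sum_sub_distrib] at h
  exact h

/-! ### Counting and separating the gaps, and integrals inside them. -/

lemma exists_finset_midpoints (n : ℕ) :
    ∃ S : Finset ℝ, S.card = 2 ^ n ∧ ∀ m ∈ S, tentMap^[n] m = 1 / 2 := by
  classical
  induction n with
  | zero => exact ⟨{1 / 2}, by simp, by simp⟩
  | succ n ih =>
    obtain ⟨S, hS, h⟩ := ih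
    have hmem : ∀ m ∈ S, m ∈ Icc (0 : ℝ) 1 := fun m hm =>
      mem_Icc_of_iterate_tentMap_mem n (by rw [h m hm]; constructor <;> norm_num)
    refine ⟨S.image (fun m => m / 3) ∪ S.image (fun m => 1 - m / 3), ?_, ?_⟩
    · rw [Finset.card_union_of_disjoint, Finset.card_image_of_injective,
        Finset.card_image_of_injective, hS, pow_succ, mul_two]
      · intro x y hxy; simp only at hxy; linarith
      · intro x y hxy; simp only at hxy; linarith
      · rw [Finset.disjoint_left]
        intro x hx hx'
        obtain ⟨m, hm, rfl⟩ := Finset.mem_image.1 hx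
        obtain ⟨k, hk, hmk⟩ := Finset.mem_image.1 hx'
        linarith [(hmem m hm).2, (hmem k hk).2]
    · intro x hx
      rw [Function.iterate_succ_apply]
      rcases Finset.mem_union.1 hx with hx | hx <;> obtain ⟨m, hm, rfl⟩ := Finset.mem_image.1 hx
      · rw [tentMap_of_le (by linarith [(hmem m hm).2]), ← h m hm]
        congr 1; ring
      · rw [tentMap_of_ge (by linarith [(hmem m hm).2]), ← h m hm]
        congr 1; ring

/-- There are `2 ^ n` gaps of generation `i + n` within distance `3 ^ (-i)` of a given point of
the Cantor set. -/
lemma exists_finset_midpoints_near (i n : ℕ) : ∀ {p : ℝ}, p ∈ cantorComplement → p ∈ Icc (0 : ℝ) 1 →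
    ∃ S : Finset ℝ, S.card = 2 ^ n ∧ ∀ m ∈ S, tentMap^[i + n] m = 1 / 2 ∧ |m - p| ≤ 1 / 3 ^ i := by
  classical
  induction i with
  | zero =>
    intro p _ hp
    obtain ⟨S, hS, h⟩ := exists_finset_midpoints n
    refine ⟨S, hS, fun m hm => ⟨by rw [zero_add]; exact h m hm, ?_⟩⟩
    have hm1 : m ∈ Icc (0 : ℝ) 1 :=
      mem_Icc_of_iterate_tentMap_mem n (by rw [h m hm]; constructor <;> norm_num)
    rw [pow_zero, div_one, abs_le]
    constructor <;> linarith [hm1.1, hm1.2, hp.1, hp.2]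
  | succ i ih =>
    intro p hpK hp
    -- Midpoints near `tentMap p` are pulled back through the branch containing `p`, which divides
    -- distances by `3`.
    obtain ⟨S, hS, h⟩ := ih (tentMap_mem_cantorComplement hpK) (tentMap_mem_Icc hp (hpK 0))
    have hmem : ∀ m ∈ S, m ∈ Icc (0 : ℝ) 1 := fun m hm =>
      mem_Icc_of_iterate_tentMap_mem (i + n) (by rw [(h m hm).1]; constructor <;> norm_num)
    have e : i + 1 + n = i + n + 1 := by ring
    rcases le_total p (1 / 2) with hp2 | hp2
    · refine ⟨S.image fun m => m / 3, ?_, ?_⟩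
      · rw [Finset.card_image_of_injective _ (fun x y hxy => by linarith), hS]
      · intro x hx
        obtain ⟨m, hm, rfl⟩ := Finset.mem_image.1 hx
        obtain ⟨h1, h2⟩ := h m hm
        rw [tentMap_of_le hp2] at h2
        constructor
        · rw [e, Function.iterate_succ_apply, tentMap_of_le (by linarith [(hmem m hm).2]), ← h1]
          congr 1; ring
        · have : m / 3 - p = (m - 3 * p) / 3 := by ring
          rw [this, abs_div, abs_of_pos (by norm_num : (0 : ℝ) < 3), pow_succ, ← div_div]
          linarith
    · refine ⟨S.image fun m => 1 - m / 3, ?_, ?_⟩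
      · rw [Finset.card_image_of_injective _ (fun x y hxy => by linarith), hS]
      · intro x hx
        obtain ⟨m, hm, rfl⟩ := Finset.mem_image.1 hx
        obtain ⟨h1, h2⟩ := h m hm
        rw [tentMap_of_ge hp2] at h2
        constructor
        · rw [e, Function.iterate_succ_apply, tentMap_of_ge (by linarith [(hmem m hm).2]), ← h1]
          congr 1; ring
        · have : 1 - m / 3 - p = -((m - 3 * (1 - p)) / 3) := by ring
          rw [this, abs_neg, abs_div, abs_of_pos (by norm_num : (0 : ℝ) < 3), pow_succ, ← div_div]
          linarith

/-- Within one branch the tent map multiplies distances by `3`; midpoints in different branches have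
the whole middle third between them. -/
lemma midpoints_separated (j : ℕ) : ∀ {m m' : ℝ}, tentMap^[j] m = 1 / 2 → tentMap^[j] m' = 1 / 2 →
    m < m' → 1 / 3 ^ j ≤ m' - m := by
  suffices H : ∀ {m m' : ℝ}, tentMap^[j] m = 1 / 2 → tentMap^[j] m' = 1 / 2 →
      m ≠ m' → 1 / 3 ^ j ≤ |m' - m| by
    intro m m' h h' hlt
    have := H h h' hlt.ne
    rwa [abs_of_pos (by linarith)] at this
  induction j with
  | zero =>
    intro m m' h h' hne
    exact absurd (h.trans h'.symm) hne
  | succ j ih =>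
    intro m m' h h' hne
    have hI : ∀ {m}, tentMap^[j + 1] m = 1 / 2 → m ≤ 1 / 3 ∨ 2 / 3 ≤ m := by
      intro m hm
      have hmI : m ∉ Ioo (1 / 3 : ℝ) (2 / 3) :=
        iterate_tentMap_notMem_Ioo (i := 0) (j := j + 1) (Nat.succ_pos j)
          (by rw [hm]; constructor <;> norm_num)
      rwa [mem_Ioo, not_and_or, not_lt, not_lt] at hmI
    have h1 : (1 : ℝ) / 3 ^ (j + 1) ≤ 1 / 3 := by
      have : (1 : ℝ) ≤ 3 ^ j := one_le_pow₀ (by norm_num)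
      rw [pow_succ]
      exact one_div_le_one_div_of_le (by norm_num) (by linarith)
    have h2 : (1 : ℝ) / 3 ^ (j + 1) = 1 / 3 ^ j / 3 := by rw [pow_succ, div_div]
    rw [Function.iterate_succ_apply] at h h'
    rcases hI h with hm | hm <;> rcases hI h' with hm' | hm'
    · have := ih h h'
      rw [tentMap_of_le (by linarith), tentMap_of_le (by linarith), ← mul_sub, abs_mul,
        abs_of_pos (by norm_num : (0 : ℝ) < 3)] at this
      linarith [this fun he => hne (by linarith)]
    · exact h1.trans (le_trans (by linarith) (le_abs_self _))
    · exact h1.trans (le_trans (by linarith) (neg_le_abs _))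
    · have := ih h h'
      rw [tentMap_of_ge (by linarith), tentMap_of_ge (by linarith), ← mul_sub, abs_mul,
        abs_of_pos (by norm_num : (0 : ℝ) < 3), show 1 - m' - (1 - m) = -(m' - m) by ring,
        abs_neg] at this
      linarith [this fun he => hne (by linarith)]

lemma mem_cantorGap_of_abs_sub_lt {j : ℕ} {m z : ℝ} (hm : tentMap^[j] m = 1 / 2)
    (hz : |z - m| < 1 / (6 * 3 ^ j)) : z ∈ cantorGap j := by
  obtain ⟨σ, hσ, h⟩ := exists_iterate_tentMap_affine j hm
  have h3 : (0 : ℝ) < 3 ^ j := by positivity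
  have hlt : (1 : ℝ) / (6 * 3 ^ j) ≤ 1 / (2 * 3 ^ j) := by gcongr; norm_num
  have h1 : |σ * 3 ^ j * (z - m)| < 1 / 6 := by
    rw [abs_mul, abs_mul, hσ, one_mul, abs_of_pos h3]
    rw [lt_div_iff₀ (by positivity)] at hz
    linarith
  rw [cantorGap, mem_ofPred_eq, h z (hz.trans_le hlt)]
  rw [abs_lt] at h1
  constructor <;> linarith [h1.1, h1.2]

/-- The orbit of the endpoint reaches `1 / 3` or `2 / 3`, then `1`, then the fixed point `0`. It
stays in `[0, 1]`, so it never meets the open middle third. -/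
lemma gap_endpoint_mem {j : ℕ} {m : ℝ} (hm : tentMap^[j] m = 1 / 2) :
    m - 1 / (6 * 3 ^ j) ∈ cantorComplement ∧ m - 1 / (6 * 3 ^ j) ∈ Icc (0 : ℝ) 1 := by
  obtain ⟨σ, hσ, h⟩ := exists_iterate_tentMap_affine j hm
  have h3 : (0 : ℝ) < 3 ^ j := by positivity
  have h1 : tentMap^[j] (m - 1 / (6 * 3 ^ j)) = 1 / 2 - σ / 6 := by
    rw [h]
    · field_simp; ring
    · rw [sub_sub_cancel_left, abs_neg, abs_of_pos (by positivity)]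
      exact one_div_lt_one_div_of_lt (by positivity) (by linarith)
  have h2 : tentMap (1 / 2 - σ / 6) = 1 := by
    rcases (abs_eq zero_le_one).1 hσ with rfl | rfl
    · rw [tentMap_of_le (by norm_num)]; norm_num
    · rw [tentMap_of_ge (by norm_num)]; norm_num
  have hz : tentMap 0 = 0 := by rw [tentMap_of_le (by norm_num)]; norm_num
  have ho : tentMap 1 = 0 := by rw [tentMap_of_ge (by norm_num)]; norm_num
  have h4 : ∀ k, tentMap^[k + 2 + j] (m - 1 / (6 * 3 ^ j)) = 0 := by
    intro k
    rw [Function.iterate_add_apply, h1, Function.iterate_succ_apply, Function.iterate_succ_apply, h2,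
      ho]
    exact Function.iterate_fixed hz k
  have h5 : ∀ k, tentMap^[k + 2 + j] (m - 1 / (6 * 3 ^ j)) ∈ Icc (0 : ℝ) 1 := fun k => by
    rw [h4]; simp
  exact ⟨fun k => iterate_tentMap_notMem_Ioo (by linarith) (h5 k),
    mem_Icc_of_iterate_tentMap_mem _ (h5 0)⟩

lemma hkIntegral_cantorExample {j : ℕ} {m c d : ℝ} (hm : tentMap^[j] m = 1 / 2) (hcd : c < d)
    (hc : m - 1 / (6 * 3 ^ j) < c) (hd : d < m + 1 / (6 * 3 ^ j)) :
    hkIntegral cantorExample c d = cantorPrimitive d - cantorPrimitive c := by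
  have hg : ∀ z ∈ Icc c d, z ∈ cantorGap j := fun z hz =>
    mem_cantorGap_of_abs_sub_lt hm (by rw [abs_lt]; constructor <;> linarith [hz.1, hz.2])
  have hcont : ContinuousOn cantorExample (Icc c d) := by
    have h1 : Continuous fun z => (9 : ℝ) ^ j * deriv (deriv (gapWave j)) (tentMap^[j] z) :=
      continuous_const.mul
        ((continuous_deriv_deriv_gapWave j).comp (continuous_tentMap.iterate j))
    exact h1.continuousOn.congr fun z hz => gapFunction_of_mem _ (hg z hz)
  rw [hkIntegral_eq_of_continuousOn hcd hcont]
  rw [← uIcc_of_le hcd.le] at hg hcont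
  exact intervalIntegral.integral_eq_sub_of_hasDerivAt
    (fun z hz => hasDerivAt_cantorPrimitive (hg z hz)) hcont.intervalIntegrable

/-- The integral from `x` up to the gap is unknown but cancels, leaving a stretch inside the gap
where the example is continuous. -/
lemma hkIntegral_cantorExample_sub (hf : HKIntegrableOn cantorExample 0 1 one_pos) {j : ℕ}
    {m x c d : ℝ} (hm : tentMap^[j] m = 1 / 2) (hx0 : 0 ≤ x) (hx : x ≤ m - 1 / (6 * 3 ^ j))
    (hc : |c - m| < 1 / (6 * 3 ^ j)) (hd : |d - m| < 1 / (6 * 3 ^ j)) :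
    hkIntegral cantorExample x d - hkIntegral cantorExample x c =
      cantorPrimitive d - cantorPrimitive c := by
  have key : ∀ {c d : ℝ}, |c - m| < 1 / (6 * 3 ^ j) → |d - m| < 1 / (6 * 3 ^ j) → c < d →
      hkIntegral cantorExample x d - hkIntegral cantorExample x c =
        cantorPrimitive d - cantorPrimitive c := by
    intro c d hc hd hcd
    have hd1 : d ≤ 1 := (mem_Icc_of_iterate_tentMap_mem j
      (Ioo_thirds_subset_Icc (mem_cantorGap_of_abs_sub_lt hm hd))).2
    rw [abs_lt] at hc hd
    rw [← hf.hkIntegral_add hx0 (by linarith) hcd hd1,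
      hkIntegral_cantorExample hm hcd (by linarith) (by linarith)]
    ring
  rcases lt_trichotomy c d with h | rfl | h
  · exact key hc hd h
  · ring
  · linarith [key hd hc h]

/-! ### Baire category and the failure of Henstock–Kurzweil integrability. -/

/-- By Baire's theorem a gauge is bounded below on a dense subset of a portion of the Cantor set. -/
lemma exists_portion_of_gauge {r : ℝ → ℝ} (hr : ∀ x, 0 < r x) :
    ∃ p ∈ cantorComplement ∩ Icc (0 : ℝ) 1, ∃ η > 0, ∃ ρ > 0,
      ∀ x ∈ cantorComplement ∩ Icc (0 : ℝ) 1, |x - p| < η → ∀ δ > 0,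
        ∃ y ∈ cantorComplement ∩ Icc (0 : ℝ) 1, ρ ≤ r y ∧ |x - y| < δ := by
  set C := cantorComplement ∩ Icc (0 : ℝ) 1 with hC
  have hcl : IsClosed C := isClosed_cantorComplement.inter isClosed_Icc
  have : CompleteSpace C := hcl.completeSpace_coe
  have h0 : (0 : ℝ) ∈ C := by
    refine ⟨fun j hj => ?_, by simp⟩
    have hz : tentMap 0 = 0 := by rw [tentMap_of_le (by norm_num)]; norm_num
    rw [cantorGap, mem_ofPred_eq, Function.iterate_fixed hz] at hj
    linarith [hj.1]
  have : Nonempty C := ⟨⟨0, h0⟩⟩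
  -- Positivity of `r` makes the sets where `r` is at least `1 / (n + 1)` cover the complete space
  -- `C`; hence one of their closures has interior points.
  obtain ⟨n, p, hp⟩ := nonempty_interior_of_iUnion_of_closed
    (f := fun n : ℕ => closure {y : C | 1 / ((n : ℝ) + 1) ≤ r y}) (fun n => isClosed_closure) (by
      refine eq_univ_of_forall fun y => ?_
      obtain ⟨n, hn⟩ := exists_nat_one_div_lt (hr y)
      exact mem_iUnion.2 ⟨n, subset_closure hn.le⟩)
  obtain ⟨η, hη, hball⟩ := Metric.mem_nhds_iff.1 (mem_interior_iff_mem_nhds.1 hp)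
  refine ⟨p, p.2, η, hη, 1 / ((n : ℝ) + 1), by positivity, fun x hx hxp δ hδ => ?_⟩
  obtain ⟨y, hy, hxy⟩ := Metric.mem_closure_iff.1 (hball (show (⟨x, hx⟩ : C) ∈ Metric.ball p η from
    hxp)) δ hδ
  exact ⟨y, y.2, hy, hxy⟩

theorem not_hkIntegrableOn_cantorExample : ¬ HKIntegrableOn cantorExample 0 1 one_pos := by
  intro hf
  obtain ⟨r, hr, hgauge⟩ := hf.exists_gauge one_pos
  obtain ⟨p, ⟨hpK, hpI⟩, η, hη, ρ, hρ, hdense⟩ := exists_portion_of_gauge hr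
  obtain ⟨i, hi⟩ : ∃ i : ℕ, 2 * (1 / 3 : ℝ) ^ i < min η ρ := by
    obtain ⟨i, hi⟩ := exists_pow_lt_of_lt_one (show 0 < min η ρ / 2 by positivity)
      (by norm_num : (1 / 3 : ℝ) < 1)
    exact ⟨i, by linarith⟩
  have hi1 : 2 * (1 / 3 ^ i : ℝ) < η := by
    rw [← one_div_pow]; exact hi.trans_le (min_le_left _ _)
  have hi2 : 2 * (1 / 3 ^ i : ℝ) < ρ := by
    rw [← one_div_pow]; exact hi.trans_le (min_le_right _ _)
  -- The left side is the number of gaps times the oscillation in each. It is a constant multiple of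
  -- `(4 / 3) ^ n`, so a uniform bound is absurd.
  have hbound : ∀ n : ℕ, 2 ^ n * (1 / 10000 * (2 / 3 : ℝ) ^ (i + n)) ≤ 2 := by
    intro n
    obtain ⟨S, hcard, hS⟩ := exists_finset_midpoints_near i n hpK hpI
    set j := i + n with hj
    set τ : ℝ := 1 / (6 * 3 ^ j) with hτ
    have hτ0 : 0 < τ := by positivity
    have hτ6 : 6 * τ = 1 / 3 ^ j := by rw [hτ]; field_simp
    have hτi : 6 * τ ≤ 1 / 3 ^ i := by
      rw [hτ6]
      exact one_div_le_one_div_of_le (by positivity) (pow_le_pow_right₀ (by norm_num) (by omega))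
    -- The gauge may be tiny at the endpoint `m - τ` itself, so the tag is a Cantor point within `2
    -- * τ` of it where the gauge is at least `ρ`. Lying outside the gap forces `x ≤ m - τ`.
    have hx : ∀ m ∈ S, ∃ x ∈ cantorComplement ∩ Icc (0 : ℝ) 1, ρ ≤ r x ∧ m - 3 * τ < x ∧
        x ≤ m - τ := by
      intro m hm
      obtain ⟨h1, h2⟩ := hS m hm
      rw [abs_le] at h2
      obtain ⟨x, hxC, hxr, hxm⟩ := hdense (m - τ) (gap_endpoint_mem h1)
        (by rw [abs_lt]; constructor <;> linarith) (2 * τ) (by linarith)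
      rw [abs_lt] at hxm
      refine ⟨x, hxC, hxr, by linarith, ?_⟩
      by_contra! hlt
      exact hxC.1 j (mem_cantorGap_of_abs_sub_lt h1 (abs_lt.2 ⟨by linarith, by linarith⟩))
    choose! x hxC hxr hx1 hx2 using hx
    have hu : ∀ m ∈ S, ∃ u v : ℝ, |u - m| < τ ∧ |v - m| < τ ∧
        1 / 10000 * (2 / 3) ^ j ≤ cantorPrimitive u - cantorPrimitive v := by
      intro m hm
      obtain ⟨z, hz, hosc⟩ := exists_cantorPrimitive_oscillation (hS m hm).1
      rcases le_abs'.1 hosc with h | h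
      · exact ⟨m, z, by simpa using hτ0, hz, by linarith⟩
      · exact ⟨z, m, hz, by simpa using hτ0, h⟩
    choose! u v hum hvm huv using hu
    -- The example vanishes at the tags, so the Henstock lemma bounds the integrals alone, for any
    -- choice of right ends in the gaps. Comparing `u` and `v` over the same tags isolates the
    -- oscillation.
    have hest : ∀ w : ℝ → ℝ, (∀ m ∈ S, |w m - m| < τ) →
        |∑ m ∈ S, hkIntegral cantorExample (x m) (w m)| ≤ 1 := by
      intro w hw
      have h := hgauge S x w (fun m hm => ?_) ?_
      · have e : ∑ m ∈ S, (cantorExample (x m) * (w m - x m) - hkIntegral cantorExample (x m) (w m))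
            = -∑ m ∈ S, hkIntegral cantorExample (x m) (w m) := by
          rw [← Finset.sum_neg_distrib]
          refine Finset.sum_congr rfl fun m hm => ?_
          rw [cantorExample, gapFunction_of_mem_complement _ (hxC m hm).1]
          ring
        rwa [e, abs_neg] at h
      · have hw1 : w m ≤ 1 := (mem_Icc_of_iterate_tentMap_mem j (Ioo_thirds_subset_Icc
          (mem_cantorGap_of_abs_sub_lt (hS m hm).1 (hw m hm)))).2
        have hwm := abs_lt.1 (hw m hm)
        have := hx1 m hm
        have := hx2 m hm
        have := hxr m hm
        exact ⟨(hxC m hm).2.1, by linarith, hw1, by linarith⟩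
      · have hlt : ∀ m ∈ S, ∀ k ∈ S, m < k → Disjoint (Ioc (x m) (w m)) (Ioc (x k) (w k)) := by
          intro m hm k hk hmk
          -- Midpoints are at least `6 * τ` apart, while each interval extends less than `τ` to the
          -- right and less than `3 * τ` to the left of its midpoint.
          have h1 := midpoints_separated j (hS m hm).1 (hS k hk).1 hmk
          have h2 := abs_lt.1 (hw m hm)
          have h3 := hx1 k hk
          rw [Set.disjoint_left]
          intro z hz hz'
          linarith [hz.2, hz'.1]
        intro m hm k hk hne
        rcases lt_or_gt_of_ne hne with h | h
        · exact hlt m hm k hk h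
        · exact (hlt k hk m hm h).symm
    have h1 := (abs_le.1 (hest u hum)).2
    have h2 := (abs_le.1 (hest v hvm)).1
    have h3 : ∑ m ∈ S, (1 / 10000 * (2 / 3 : ℝ) ^ j) ≤
        ∑ m ∈ S, (hkIntegral cantorExample (x m) (u m) - hkIntegral cantorExample (x m) (v m)) := by
      refine Finset.sum_le_sum fun m hm => ?_
      rw [hkIntegral_cantorExample_sub hf (hS m hm).1 (hxC m hm).2.1 (hx2 m hm) (hvm m hm)
        (hum m hm)]
      exact huv m hm
    rw [Finset.sum_sub_distrib, Finset.sum_const, hcard, nsmul_eq_mul] at h3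
    push_cast at h3
    linarith
  have hpos : (0 : ℝ) < 1 / 10000 * (2 / 3) ^ i := by positivity
  obtain ⟨n, hn⟩ := pow_unbounded_of_one_lt (2 / (1 / 10000 * (2 / 3 : ℝ) ^ i))
    (by norm_num : (1 : ℝ) < 4 / 3)
  rw [div_lt_iff₀ hpos] at hn
  have e : (2 : ℝ) ^ n * (1 / 10000 * (2 / 3 : ℝ) ^ (i + n)) =
      (4 / 3) ^ n * (1 / 10000 * (2 / 3 : ℝ) ^ i) := by
    rw [pow_add, show (4 / 3 : ℝ) = 2 * (2 / 3) by norm_num, mul_pow]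
    ring
  linarith [hbound n]

theorem mainTheorem5 :
    (∀ f : ℝ → ℝ, LocallyLaplaceIntegrable f → LebesgueIntegrableNearInfty f →
      ∀ y : ℝ, LaplaceFourierExistsAt f y) ∧
    (∀ f : ℝ → ℝ, LaplaceIntegrable f → BoundedVariationNearInfty f →
      ∀ y : ℝ, LaplaceFourierExistsAt f y) ∧
    (∃ f : ℝ → ℝ, LaplaceIntegrable f ∧ (∀ x, x ∉ Set.Icc (0 : ℝ) 1 → f x = 0) ∧
      ¬ LocallyHKIntegrable f ∧ ∀ y : ℝ, LaplaceFourierExistsAt f y) := by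
  have hF := laplaceFourierExistsAt_of_lebesgueIntegrableNearInfty
    locallyLaplaceIntegrable_cantorExample lebesgueIntegrableNearInfty_cantorExample
  refine ⟨fun f => laplaceFourierExistsAt_of_lebesgueIntegrableNearInfty,
    fun f => laplaceFourierExistsAt_of_boundedVariationNearInfty,
    cantorExample, ?_, fun x => cantorExample_of_notMem_Icc,
    fun h => not_hkIntegrableOn_cantorExample (h 0 1 one_pos), hF⟩
  -- At frequency `0` the exponential is `1`, so the real part of the transform is the integral of
  -- the example.
  obtain ⟨z, hz, -⟩ := hF 0
  refine ⟨z.re, ?_⟩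
  simpa using hz
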